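/- Let $A$ and $B$ be finite-dimensional quantum systems (nonzero complex Hilbert spaces with fixed orthonormal bases), let $\mathrm{CP}$, $\mathrm{CPTP}$ and $\mathrm{CPTNI}$ be the sets of completely positive, completely positive trace-preserving, and completely positive trace-nonincreasing linear maps from operators on $A$ to operators on $B$, and let $J_\Phi=(\mathrm{id}_A\otimes\Phi)(|\Omega\rangle\langle\Omega|)$, $|\Omega\rangle=\sum_i|ii\rangle$, be the Choi operator of a linear map $\Phi$. Put $$R'(\Phi)=\min\{\lambda\ge -1 \;:\; J_\Phi\le(1+\lambda)J_\Lambda \text{ for some } \Lambda\in\mathrm{CPTNI}\},\qquad \|\Phi\|_\diamond=\max_{\rho}\|(\mathrm{id}_A\otimes\Phi)(\rho)\|_1,$$ the maximum being over density operators $\rho$ on $A\otimes A$. An input-output game $\mathcal G$ consists of a finite ensemble $\{p_i,\sigma_i\}_i$ of density operators on $A$, a finite POVM $\{M_j\}_j$ on $B$ and real coefficients $w_{ij}$; its payoff for a map $\Phi$ is $P(\Phi,\mathcal G)=\sum_{i,j}w_{ij}\,p_i\,\mathrm{Tr}\big(M_j\Phi(\sigma_i)\big)$. Let $\Phi$ be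 a Hermiticity-preserving linear map from operators on $A$ to operators on $B$. Then the extrema defining $R'(\Phi)$ and $\|\Phi\|_\diamond$, and $\max_{\Lambda\in\mathrm{CPTP}}P(\Lambda,\mathcal G)$ for every game $\mathcal G$, are attained, and $$\sup_{\mathcal G}\frac{P(\Phi,\mathcal G)}{\max_{\Lambda\in\mathrm{CPTP}}P(\Lambda,\mathcal G)}=R'(\Phi)+1,$$ where the supremum is over all games with $P(\Gamma,\mathcal G)\ge0$ for all $\Gamma\in\mathrm{CP}$, and where the ratio is read as $0$ if its denominator vanishes. If $-J_\Phi$ is not positive definite, the same equality holds with the supremum restricted to those games whose denominator is nonzero. If $\Phi$ is moreover trace preserving, then $$\sup_{\mathcal G}\frac{P(\Phi,\mathcal G)}{\max_{\Lambda\in\mathrm{CPTP}}P(\Lambda,\mathcal G)}=\frac{\|\Phi\|_\diamond+1}{2},$$ both when the supremum is over all games with $P(\Gamma,\mathcal G)\ge0$ for all $\Gamma\in\mathrm{CP}$ and nonzero denominator, and when it is over all games with $P(\Lambda,\mathcal G)\ge0$ for all $\Lambda\in\mathrm{CPTP}$ and nonzero denominator. -/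

import Mathlib

open scoped Matrix Kronecker ComplexOrder

namespace QuantumGames

/-! Operators on a quantum system with orthonormal basis `A` are matrices indexed by `A`. -/

variable {A B R : Type*} [Fintype A] [Fintype B] [Fintype R]

/-- Linear maps from operators on `A` to operators on `B`. -/
abbrev LMap (A B : Type*) : Type _ := Matrix A A ℂ →ₗ[ℂ] Matrix B B ℂ

/-- The density operators on `A`: positive semidefinite with unit trace. -/
def densityOperators (A : Type*) [Fintype A] : Set (Matrix A A ℂ) :=
  {ρ | ρ.PosSemidef ∧ ρ.trace = 1}

/-- The action of `id_R ⊗ Φ` on operators on `R ⊗ A`: the map `Φ` is applied to each of the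
`A`-blocks. -/
def idTensor (R : Type*) (Φ : LMap A B) (X : Matrix (R × A) (R × A) ℂ) :
    Matrix (R × B) (R × B) ℂ :=
  Matrix.of fun x y => Φ (Matrix.of fun a a' => X (x.1, a) (y.1, a')) x.2 y.2

/-- `Φ` maps Hermitian operators to Hermitian operators. -/
def HermiticityPreserving (Φ : LMap A B) : Prop :=
  ∀ X : Matrix A A ℂ, X.IsHermitian → (Φ X).IsHermitian

/-- `Φ` is completely positive: `id_A ⊗ Φ` is a positive map. -/
def CompletelyPositive (Φ : LMap A B) : Prop :=
  ∀ X : Matrix (A × A) (A × A) ℂ, X.PosSemidef → (idTensor A Φ X).PosSemidef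

/-- `Φ` preserves the trace. -/
def TracePreserving (Φ : LMap A B) : Prop :=
  ∀ X : Matrix A A ℂ, (Φ X).trace = X.trace

/-- `Φ` does not increase the trace of positive semidefinite operators. -/
def TraceNonincreasing (Φ : LMap A B) : Prop :=
  ∀ X : Matrix A A ℂ, X.PosSemidef → (Φ X).trace ≤ X.trace

/-- The completely positive maps. -/
def CP (A B : Type*) [Fintype A] [Fintype B] : Set (LMap A B) :=
  {Φ | CompletelyPositive Φ}

/-- The completely positive trace-preserving maps (quantum channels). -/
def CPTP (A B : Type*) [Fintype A] [Fintype B] : Set (LMap A B) :=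
  {Φ | CompletelyPositive Φ ∧ TracePreserving Φ}

/-- The completely positive trace-nonincreasing maps. -/
def CPTNI (A B : Type*) [Fintype A] [Fintype B] : Set (LMap A B) :=
  {Φ | CompletelyPositive Φ ∧ TraceNonincreasing Φ}

/-- The unnormalised maximally entangled vector `∑ i, |i⟩ ⊗ |i⟩`. -/
def maxEntangled (A : Type*) [DecidableEq A] : A × A → ℂ :=
  fun x => if x.1 = x.2 then 1 else 0

/-- The Choi operator `J_Φ = (id_A ⊗ Φ)(|Ω⟩⟨Ω|)`. -/
def choi [DecidableEq A] (Φ : LMap A B) : Matrix (A × B) (A × B) ℂ :=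
  idTensor A Φ (Matrix.vecMulVec (maxEntangled A) (star (maxEntangled A)))

/-- The numbers `lam ≥ -1` such that `J_Φ ≤ (1 + lam) J_Λ` for some CPTNI map `Λ`. -/
def robustnessFeasible [DecidableEq A] (Φ : LMap A B) : Set ℝ :=
  {lam | -1 ≤ lam ∧ ∃ Λ ∈ CPTNI A B, ((1 + lam) • choi Λ - choi Φ).PosSemidef}

/-- The generalised robustness `R'(Φ)`. -/
noncomputable def robustness' [DecidableEq A] (Φ : LMap A B) : ℝ :=
  sInf (robustnessFeasible Φ)

/-- The trace norm: the sum of the singular values (square roots of the eigenvalues of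
`Xᴴ * X`). -/
noncomputable def traceNorm [DecidableEq R] (X : Matrix R R ℂ) : ℝ :=
  ∑ i, Real.sqrt ((Matrix.isHermitian_conjTranspose_mul_self X).eigenvalues i)

/-- The values `‖(id_A ⊗ Φ)(ρ)‖₁` for density operators `ρ` on `A ⊗ A`. -/
def diamondValues [DecidableEq A] [DecidableEq B] (Φ : LMap A B) : Set ℝ :=
  {x | ∃ ρ ∈ densityOperators (A × A), x = traceNorm (idTensor A Φ ρ)}

/-- The diamond norm. -/
noncomputable def diamondNorm [DecidableEq A] [DecidableEq B] (Φ : LMap A B) : ℝ :=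
  sSup (diamondValues Φ)

/-- An input-output game: an ensemble `{p i, σ i}` of states on `A`, a POVM `{M j}` on `B`, and
real reward coefficients `w i j`. -/
structure Game (A B : Type*) [Fintype A] [Fintype B] [DecidableEq B] where
  /-- number of states -/
  n : ℕ
  /-- number of measurement outcomes -/
  m : ℕ
  /-- probabilities of the states -/
  p : Fin n → ℝ
  p_nonneg : ∀ i, 0 ≤ p i
  p_sum : ∑ i, p i = 1
  /-- the states -/
  σ : Fin n → Matrix A A ℂ
  σ_mem : ∀ i, σ i ∈ densityOperators A
  /-- the measurement operators -/
  M : Fin m → Matrix B B ℂ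
  M_pos : ∀ j, (M j).PosSemidef
  M_sum : ∑ j, M j = 1
  /-- the rewards -/
  w : Fin n → Fin m → ℝ

namespace Game

variable [DecidableEq B]

/-- The average payoff `∑ i j, w i j * p i * ⟨M j, Φ (σ i)⟩`, where `⟨X, Y⟩ = Tr (Xᴴ Y)`. The
inner products are real for every Hermiticity-preserving `Φ`. -/
def payoff (G : Game A B) (Φ : LMap A B) : ℝ :=
  ∑ i, ∑ j, G.w i j * G.p i * ((G.M j)ᴴ * Φ (G.σ i)).trace.re

/-- The payoffs that quantum channels achieve. -/
def channelPayoffs (G : Game A B) : Set ℝ :=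
  {x | ∃ Λ ∈ CPTP A B, x = G.payoff Λ}

/-- The best payoff of a quantum channel. -/
noncomputable def maxChannelPayoff (G : Game A B) : ℝ :=
  sSup G.channelPayoffs

end Game

/-- The games for which all maps in `S` have a nonnegative payoff. -/
def gamesNonnegOn [DecidableEq B] (S : Set (LMap A B)) : Set (Game A B) :=
  {G | ∀ Γ ∈ S, 0 ≤ G.payoff Γ}

/-- The ratios `P(Φ,G) / max_{Λ ∈ CPTP} P(Λ,G)` for the games `G` in `C` whose denominator does
not vanish. -/
def advantages [DecidableEq B] (C : Set (Game A B)) (Φ : LMap A B) : Set ℝ :=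
  {x | ∃ G ∈ C, G.maxChannelPayoff ≠ 0 ∧ x = G.payoff Φ / G.maxChannelPayoff}

/-- The ratios for all games in `C`, with the convention that a ratio with zero denominator
is `0`. -/
def advantagesWithZero [DecidableEq B] (C : Set (Game A B)) (Φ : LMap A B) : Set ℝ :=
  {x | ∃ G ∈ C, x = if G.maxChannelPayoff = 0 then 0 else G.payoff Φ / G.maxChannelPayoff}

end QuantumGames

/-! Everything is expressed through Choi operators: a payoff is a real-linear functional of `choi
Φ`. Conversely, tomographically complete states and effects turn every such functional on
Hermiticity-preserving maps into a game (`exists_game`), so the supremum over games is one over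
operators `W`.

Upper bound: at the optimal robustness some channel `Λ` makes `(R' + 1) Λ - Φ` completely positive
(`exists_CPTP_dominating`). Its payoff is nonnegative, hence `P(Φ) ≤ (R' + 1) P(Λ)`.

Lower bound: for `μ < R' + 1` the operator `μ • 1` lies outside the closed convex set
`partialTraceBounds`. Separation yields an invertible state `ρ = Cᴴ C` with `μ ≤ Tr (ρ Tr_B K)` for
all positive `K ≥ J`. With `D = C ⊗ 1`, the choice of `K` that pulls back the positive part of `D J
Dᴴ` gives `μ ≤ Tr (P D J Dᴴ)` for an effect `P` (`exists_witness_of_notMem_bounds`). The game of `W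
= Dᴴ P D` then pays at least `μ` on `Φ` and at most `1` on channels.

For trace-preserving `Φ` the same witness is a pure input state and an effect. Since `‖X‖₁ = max_P
(2 Tr (P X) - Tr X)` and the output has trace one, this identifies `R' + 1` with `(‖Φ‖_⋄ + 1) / 2`.
-/

namespace QuantumGames

variable {A B R : Type*} [Fintype A] [Fintype B] [Fintype R]

/-! ### Positive semidefinite matrices: trace pairing, trace norm, compactness. -/

section Matrices

open Matrix

section
open scoped MatrixOrder

theorem exists_eq_conjTranspose_mul_self [DecidableEq R] {X : Matrix R R ℂ} (hX : X.PosSemidef) :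
    ∃ Z : Matrix R R ℂ, X = Zᴴ * Z := by
  obtain ⟨Z, hZ⟩ := CStarAlgebra.nonneg_iff_eq_star_mul_self.mp
    (Matrix.nonneg_iff_posSemidef.mpr hX)
  exact ⟨Z, hZ⟩

end

theorem trace_mul_re_nonneg {X Y : Matrix R R ℂ} (hX : X.PosSemidef) (hY : Y.PosSemidef) :
    0 ≤ (X * Y).trace.re := by
  classical
  obtain ⟨Z, rfl⟩ := exists_eq_conjTranspose_mul_self hX
  have h := (hY.mul_mul_conjTranspose_same Z).trace_nonneg
  rw [Matrix.mul_assoc, Matrix.trace_mul_comm]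
  exact (Complex.nonneg_iff.mp h).1

theorem trace_re_nonneg {X : Matrix R R ℂ} (hX : X.PosSemidef) : 0 ≤ X.trace.re :=
  (Complex.nonneg_iff.mp hX.trace_nonneg).1

theorem trace_mul_vecMulVec_star (N : Matrix R R ℂ) (v : R → ℂ) :
    (N * vecMulVec v (star v)).trace = star v ⬝ᵥ (N *ᵥ v) := by
  rw [Matrix.mul_vecMulVec, Matrix.trace_vecMulVec, dotProduct_comm]

theorem IsHermitian.im_dotProduct {N : Matrix R R ℂ} (hN : N.IsHermitian) (v : R → ℂ) :
    (star v ⬝ᵥ (N *ᵥ v)).im = 0 :=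
  hN.im_star_dotProduct_mulVec_self v

theorem posSemidef_of_re_dotProduct_nonneg {N : Matrix R R ℂ} (hN : N.IsHermitian)
    (h : ∀ v, 0 ≤ (star v ⬝ᵥ (N *ᵥ v)).re) : N.PosSemidef :=
  .of_dotProduct_mulVec_nonneg hN fun v =>
    Complex.nonneg_iff.mpr ⟨h v, (IsHermitian.im_dotProduct hN v).symm⟩

theorem IsHermitian.im_trace {N : Matrix R R ℂ} (hN : N.IsHermitian) : N.trace.im = 0 := by
  have h := Matrix.trace_conjTranspose N
  rw [hN.eq] at h
  have := congrArg Complex.im h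
  simp at this
  linarith

theorem IsHermitian.im_trace_mul {M N : Matrix R R ℂ} (hM : M.IsHermitian) (hN : N.IsHermitian) :
    (M * N).trace.im = 0 := by
  have h := Matrix.trace_conjTranspose (M * N)
  rw [conjTranspose_mul, hM.eq, hN.eq, Matrix.trace_mul_comm] at h
  have := congrArg Complex.im h
  simp at this
  linarith

/-- The enumeration in `eigenvalues` is not controlled, but the characteristic polynomial determines
the eigenvalues as a multiset, which is enough for a symmetric sum. -/
theorem sum_eigenvalues_eq_of_conj_diagonal [DecidableEq R] {Y : Matrix R R ℂ}
    (hY : Y.IsHermitian) (U : Matrix R R ℂ) (hU : Uᴴ * U = 1) (d : R → ℝ)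
    (h : Y = U * diagonal (fun i => (d i : ℂ)) * Uᴴ) (f : ℝ → ℝ) :
    ∑ i, f (hY.eigenvalues i) = ∑ i, f (d i) := by
  have h1 : Y.charpoly = (diagonal (fun i => (d i : ℂ))).charpoly := by
    rw [h, Matrix.charpoly_mul_comm, ← Matrix.mul_assoc, hU, Matrix.one_mul]
  have h2 := hY.roots_charpoly_eq_eigenvalues
  rw [h1, Matrix.charpoly_diagonal, Polynomial.roots_prod _ _
    (by simp [Finset.prod_ne_zero_iff, Polynomial.X_sub_C_ne_zero])] at h2
  have h3 := congrArg (fun s => (s.map fun z : ℂ => f z.re).sum) h2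
  simpa [Multiset.map_map, Function.comp_def] using h3.symm

/-- The spectral data of a Hermitian operator that the trace norm needs: its positive and negative
parts and the projection onto the positive part. -/
theorem exists_posPart_negPart [DecidableEq R] {X : Matrix R R ℂ} (hX : X.IsHermitian) :
    ∃ Y Z P : Matrix R R ℂ, Y.PosSemidef ∧ Z.PosSemidef ∧ P.PosSemidef ∧ (1 - P).PosSemidef ∧
      X = Y - Z ∧ P * X = Y ∧ traceNorm X = Y.trace.re + Z.trace.re ∧
      (traceNorm X • (1 : Matrix R R ℂ) - X).PosSemidef := by
  let U : Matrix R R ℂ := hX.eigenvectorUnitary.1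
  have hU1 : Uᴴ * U = 1 := by
    rw [← star_eq_conjTranspose]; exact Unitary.coe_star_mul_self hX.eigenvectorUnitary
  have hU2 : U * Uᴴ = 1 := by
    rw [← star_eq_conjTranspose]; exact Unitary.coe_mul_star_self hX.eigenvectorUnitary
  set l := hX.eigenvalues
  -- Functional calculus in the eigenbasis of `X`: products, differences, positivity and traces of
  -- `F g` reduce each claim to one about real eigenvalues.
  let F : (R → ℝ) → Matrix R R ℂ := fun g => U * diagonal (fun i => (g i : ℂ)) * Uᴴ
  have hXF : X = F l := hX.spectral_theorem
  have hFmul (g k : R → ℝ) : F g * F k = F (fun i => g i * k i) := by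
    calc F g * F k = U * diagonal (fun i => (g i : ℂ)) * (Uᴴ * U) *
          (diagonal (fun i => (k i : ℂ))) * Uᴴ := by simp only [F, Matrix.mul_assoc]
      _ = _ := by
        rw [hU1, Matrix.mul_one, Matrix.mul_assoc U, Matrix.diagonal_mul_diagonal]
        simp [F]
  have hFsub (g k : R → ℝ) : F g - F k = F (fun i => g i - k i) := by
    simp only [F, ← Matrix.sub_mul, ← Matrix.mul_sub, Matrix.diagonal_sub]
    simp
  have hFone (c : ℝ) : F (fun _ => c) = c • (1 : Matrix R R ℂ) := by
    have : diagonal (fun _ : R => (c : ℂ)) = c • (1 : Matrix R R ℂ) := by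
      ext i j; by_cases h : i = j <;> simp [h]
    simp only [F, this, Matrix.mul_smul, Matrix.mul_one, Matrix.smul_mul, hU2]
  have hFpsd (g : R → ℝ) (hg : ∀ i, 0 ≤ g i) : (F g).PosSemidef :=
    (Matrix.PosSemidef.diagonal fun i => by simpa using hg i).mul_mul_conjTranspose_same U
  have hFtr (g : R → ℝ) : (F g).trace.re = ∑ i, g i := by
    simp only [F]
    rw [Matrix.trace_mul_comm, ← Matrix.mul_assoc, hU1, Matrix.one_mul, Matrix.trace_diagonal]
    simp
  have htn : traceNorm X = ∑ i, |l i| := by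
    have h := sum_eigenvalues_eq_of_conj_diagonal (isHermitian_conjTranspose_mul_self X) U hU1
      (fun i => l i * l i) (by rw [hX.eq]; conv_lhs => rw [hXF, hFmul]) Real.sqrt
    simpa [traceNorm, Real.sqrt_mul_self_eq_abs] using h
  refine ⟨F fun i => max (l i) 0, F fun i => max (-l i) 0, F fun i => if 0 < l i then 1 else 0,
    hFpsd _ fun i => le_max_right _ _, hFpsd _ fun i => le_max_right _ _,
    hFpsd _ fun i => by split_ifs <;> norm_num, ?_, ?_, ?_, ?_, ?_⟩
  · have : (1 : Matrix R R ℂ) = F fun _ => 1 := by rw [hFone, one_smul]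
    rw [this, hFsub]
    exact hFpsd _ fun i => by split_ifs <;> norm_num
  · rw [hFsub]
    conv_lhs => rw [hXF]
    congr 1
    ext i
    rcases le_total 0 (l i) with h | h <;> simp [h]
  · conv_lhs => rw [hXF, hFmul]
    congr 1
    ext i
    split_ifs with h
    · simp [h.le]
    · simp [not_lt.mp h]
  · rw [htn, hFtr, hFtr, ← Finset.sum_add_distrib]
    refine Finset.sum_congr rfl fun i _ => ?_
    rcases le_total 0 (l i) with h | h <;> simp [h, abs_of_nonneg, abs_of_nonpos]
  · rw [← hFone]
    conv => enter [1, 2]; rw [hXF]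
    rw [hFsub]
    refine hFpsd _ fun i => ?_
    rw [htn, sub_nonneg]
    exact (le_abs_self _).trans
      (Finset.single_le_sum (f := fun i => |l i|) (fun i _ => abs_nonneg _) (Finset.mem_univ i))

theorem traceNorm_nonneg [DecidableEq R] (X : Matrix R R ℂ) : 0 ≤ traceNorm X :=
  Finset.sum_nonneg fun _ _ => Real.sqrt_nonneg _

/-- The trace norm of a Hermitian operator as a maximum over effects. -/
theorem isGreatest_traceNorm [DecidableEq R] {X : Matrix R R ℂ} (hX : X.IsHermitian) :
    IsGreatest {x | ∃ P : Matrix R R ℂ, P.PosSemidef ∧ (1 - P).PosSemidef ∧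
      x = 2 * (P * X).trace.re - X.trace.re} (traceNorm X) := by
  obtain ⟨Y, Z, P, hY, hZ, hP, hP1, hXYZ, hPX, ht, -⟩ := exists_posPart_negPart hX
  constructor
  · refine ⟨P, hP, hP1, ?_⟩
    rw [hPX, ht]
    conv => enter [2, 2]; rw [hXYZ]
    rw [Matrix.trace_sub, Complex.sub_re]
    ring
  · rintro _ ⟨Q, hQ, hQ1, rfl⟩
    have h1 := trace_mul_re_nonneg hQ1 hY
    have h2 := trace_mul_re_nonneg hQ hZ
    rw [Matrix.sub_mul, Matrix.one_mul, Matrix.trace_sub, Complex.sub_re] at h1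
    rw [ht, hXYZ, Matrix.mul_sub, Matrix.trace_sub, Matrix.trace_sub, Complex.sub_re,
      Complex.sub_re]
    linarith

theorem isClosed_posSemidef : IsClosed {K : Matrix R R ℂ | K.PosSemidef} := by
  have : {K : Matrix R R ℂ | K.PosSemidef} =
      {K | Kᴴ = K} ∩ ⋂ v : R → ℂ, {K | 0 ≤ (star v ⬝ᵥ (K *ᵥ v)).re} := by
    ext K
    simp only [Set.mem_ofPred_eq, Set.mem_inter_iff, Set.mem_iInter]
    exact ⟨fun h => ⟨h.1, fun v => (Complex.nonneg_iff.mp (h.dotProduct_mulVec_nonneg v)).1⟩,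
      fun h => posSemidef_of_re_dotProduct_nonneg h.1 h.2⟩
  rw [this]
  refine (isClosed_eq (by fun_prop) (by fun_prop)).inter (isClosed_iInter fun v => ?_)
  exact isClosed_le (by fun_prop) (by fun_prop)

/-- Entries are inner products of columns of `Z`, whose squared norms are diagonal entries of `K`.
The crude constant suffices for compactness. -/
theorem norm_apply_le_trace_re {K : Matrix R R ℂ} (hK : K.PosSemidef) (i j : R) :
    ‖K i j‖ ≤ 2 * K.trace.re := by
  classical
  obtain ⟨Z, rfl⟩ := exists_eq_conjTranspose_mul_self hK
  have hd (i : R) : ((Zᴴ * Z) i i).re = ∑ k, ‖Z k i‖ ^ 2 := by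
    simp only [Matrix.mul_apply, Complex.re_sum, conjTranspose_apply]
    exact Finset.sum_congr rfl fun k _ => by
      simp [Complex.mul_re, ← Complex.normSq_eq_norm_sq, Complex.normSq_apply]
  have hle (i : R) : ∑ k, ‖Z k i‖ ^ 2 ≤ (Zᴴ * Z).trace.re := by
    simp only [Matrix.trace, Complex.re_sum, Matrix.diag_apply, hd]
    exact Finset.single_le_sum (f := fun i => ∑ k, ‖Z k i‖ ^ 2)
      (fun i _ => Finset.sum_nonneg fun k _ => by positivity) (Finset.mem_univ i)
  calc ‖(Zᴴ * Z) i j‖ ≤ ∑ k, ‖Z k i‖ * ‖Z k j‖ := by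
        rw [Matrix.mul_apply]
        refine (norm_sum_le _ _).trans (le_of_eq ?_)
        simp
    _ ≤ ∑ k, (‖Z k i‖ ^ 2 + ‖Z k j‖ ^ 2) := Finset.sum_le_sum fun k _ => by
        nlinarith [sq_nonneg (‖Z k i‖ - ‖Z k j‖), sq_nonneg ‖Z k i‖, sq_nonneg ‖Z k j‖]
    _ ≤ _ := by rw [Finset.sum_add_distrib]; linarith [hle i, hle j]

theorem isCompact_posSemidef_trace_le (c : ℝ) :
    IsCompact {K : Matrix R R ℂ | K.PosSemidef ∧ K.trace.re ≤ c} := by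
  have hc : IsCompact (Set.univ.pi fun _ : R => Set.univ.pi fun _ : R =>
      Metric.closedBall (0 : ℂ) (2 * c)) :=
    isCompact_univ_pi fun _ => isCompact_univ_pi fun _ => isCompact_closedBall _ _
  refine IsCompact.of_isClosed_subset hc ?_ ?_
  · exact isClosed_posSemidef.inter
      (isClosed_le (f := fun K : Matrix R R ℂ => K.trace.re) (by fun_prop) continuous_const)
  · rintro K ⟨hK, ht⟩ i - j -
    simpa using (norm_apply_le_trace_re hK i j).trans (by linarith)

end Matrices

/-! ### The Choi correspondence and its dictionary for CP, TP and TNI maps. -/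

section Choi

set_option linter.unusedSectionVars false

open Matrix

variable [DecidableEq A]

/-- The linear map with a given Choi operator. -/
def ofChoi (K : Matrix (A × B) (A × B) ℂ) : LMap A B where
  toFun X := Matrix.of fun b b' => ∑ a, ∑ a', X a a' * K (a, b) (a', b')
  map_add' X Y := by
    ext b b'
    simp [add_mul, Finset.sum_add_distrib]
  map_smul' c X := by
    ext b b'
    simp [Finset.mul_sum, mul_assoc]

/-- The partial trace over the second system. -/
def partialTrace (K : Matrix (A × B) (A × B) ℂ) : Matrix A A ℂ :=
  ∑ b, K.submatrix (fun a => (a, b)) (fun a => (a, b))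

theorem partialTrace_apply (K : Matrix (A × B) (A × B) ℂ) (a a' : A) :
    partialTrace K a a' = ∑ b, K (a, b) (a', b) := by
  simp [partialTrace, Matrix.sum_apply]

theorem choi_apply (Φ : LMap A B) (a a' : A) (b b' : B) :
    choi Φ (a, b) (a', b') = Φ (single a a' 1) b b' := by
  simp only [choi, idTensor, Matrix.of_apply]
  refine congrArg (fun Y => Φ Y b b') (Matrix.ext fun c c' => ?_)
  simp only [vecMulVec_apply, maxEntangled, single_apply, Matrix.of_apply, Pi.star_apply, ite_and]
  split_ifs <;> simp

theorem apply_eq_sum_choi (Φ : LMap A B) (X : Matrix A A ℂ) (b b' : B) :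
    Φ X b b' = ∑ a, ∑ a', X a a' * choi Φ (a, b) (a', b') := by
  conv_lhs => rw [matrix_eq_sum_single X]
  simp only [map_sum, Matrix.sum_apply, choi_apply]
  refine Finset.sum_congr rfl fun a _ => Finset.sum_congr rfl fun a' _ => ?_
  rw [← mul_one (X a a'), ← smul_eq_mul, ← smul_single, map_smul]
  simp

theorem choi_ofChoi (K : Matrix (A × B) (A × B) ℂ) : choi (ofChoi K : LMap A B) = K := by
  ext ⟨a, b⟩ ⟨a', b'⟩
  simp [choi_apply, ofChoi, single_apply, ite_and]

theorem idTensor_eq_sum_choi (Φ : LMap A B) (X : Matrix (R × A) (R × A) ℂ) (r r' : R) (b b' : B) :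
    idTensor R Φ X (r, b) (r', b') =
      ∑ a, ∑ a', X (r, a) (r', a') * choi Φ (a, b) (a', b') := by
  simp [idTensor, apply_eq_sum_choi Φ]

theorem choi_add (Φ Ψ : LMap A B) : choi (Φ + Ψ) = choi Φ + choi Ψ := by
  ext ⟨a, b⟩ ⟨a', b'⟩; simp [choi_apply]

theorem choi_sub (Φ Ψ : LMap A B) : choi (Φ - Ψ) = choi Φ - choi Ψ := by
  ext ⟨a, b⟩ ⟨a', b'⟩; simp [choi_apply]

theorem choi_smul (c : ℝ) (Φ : LMap A B) : choi (c • Φ) = c • choi Φ := by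
  ext ⟨a, b⟩ ⟨a', b'⟩; simp [choi_apply]

theorem partialTrace_sub (K L : Matrix (A × B) (A × B) ℂ) :
    partialTrace (K - L) = partialTrace K - partialTrace L := by
  ext; simp [partialTrace_apply]

theorem partialTrace_add (K L : Matrix (A × B) (A × B) ℂ) :
    partialTrace (K + L) = partialTrace K + partialTrace L := by
  ext; simp [partialTrace_apply, Finset.sum_add_distrib]

theorem partialTrace_smul (c : ℝ) (K : Matrix (A × B) (A × B) ℂ) :
    partialTrace (c • K) = c • partialTrace K := by
  ext; simp [partialTrace_apply, Finset.mul_sum]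

theorem partialTrace_kronecker_one [DecidableEq B] (M : Matrix A A ℂ) :
    partialTrace (M ⊗ₖ (1 : Matrix B B ℂ)) = (Fintype.card B : ℝ) • M := by
  ext; simp [partialTrace_apply]

theorem partialTrace_posSemidef {K : Matrix (A × B) (A × B) ℂ} (hK : K.PosSemidef) :
    (partialTrace K).PosSemidef :=
  Matrix.posSemidef_sum _ fun _ _ => hK.submatrix _

theorem partialTrace_isHermitian {K : Matrix (A × B) (A × B) ℂ} (hK : K.IsHermitian) :
    (partialTrace K).IsHermitian := by
  ext a a'
  simp only [conjTranspose_apply, partialTrace_apply, star_sum, hK.apply]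

theorem trace_partialTrace (K : Matrix (A × B) (A × B) ℂ) : (partialTrace K).trace = K.trace := by
  simp [Matrix.trace, partialTrace_apply, Fintype.sum_prod_type]

theorem trace_kronecker_one_mul [DecidableEq B] (M : Matrix A A ℂ)
    (K : Matrix (A × B) (A × B) ℂ) :
    ((M ⊗ₖ (1 : Matrix B B ℂ)) * K).trace = (M * partialTrace K).trace := by
  simp only [Matrix.trace, Matrix.diag_apply, Matrix.mul_apply, Fintype.sum_prod_type,
    partialTrace_apply, kroneckerMap_apply, one_apply, mul_ite, mul_one, mul_zero, ite_mul,
    zero_mul, Finset.sum_ite_eq, Finset.mem_univ, if_true, Finset.mul_sum]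
  exact Finset.sum_congr rfl fun a _ => Finset.sum_comm

/-- The transpose comes from the Choi convention; it is harmless later, because it fixes `1` and
preserves positivity. -/
theorem trace_apply_eq (Φ : LMap A B) (X : Matrix A A ℂ) :
    (Φ X).trace = (X * (partialTrace (choi Φ))ᵀ).trace := by
  simp only [Matrix.trace, Matrix.diag_apply, Matrix.mul_apply, apply_eq_sum_choi Φ,
    partialTrace_apply, transpose_apply, Finset.mul_sum]
  rw [Finset.sum_comm]
  exact Finset.sum_congr rfl fun a _ => Finset.sum_comm

theorem tracePreserving_iff (Φ : LMap A B) :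
    TracePreserving Φ ↔ partialTrace (choi Φ) = 1 := by
  constructor
  · intro h
    ext a a'
    have := h (single a a' 1)
    rw [trace_apply_eq, Matrix.trace_mul_comm, Matrix.trace_mul_single] at this
    simp only [transpose_apply] at this
    by_cases haa : a = a'
    · subst haa; simpa using this
    · simpa [haa, Matrix.trace_single_eq_of_ne _ _ _ haa] using this
  · intro h X
    rw [trace_apply_eq, h]
    simp

theorem choi_posSemidef {Φ : LMap A B} (h : CompletelyPositive Φ) : (choi Φ).PosSemidef :=
  h _ (posSemidef_vecMulVec_self_star _)

/-- The vector with coefficient matrix `C` is `(C ⊗ 1)|Ω⟩`, and `C` acts on the reference system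
while `Φ` acts on the other factor. -/
theorem idTensor_vecMulVec [DecidableEq B] (Φ : LMap A B) (C : Matrix R A ℂ) :
    idTensor R Φ (vecMulVec (fun x => C x.1 x.2) (star fun x => C x.1 x.2)) =
      (C ⊗ₖ (1 : Matrix B B ℂ)) * choi Φ * (C ⊗ₖ (1 : Matrix B B ℂ))ᴴ := by
  ext ⟨r, b⟩ ⟨r', b'⟩
  rw [idTensor_eq_sum_choi]
  simp only [Matrix.mul_apply, Fintype.sum_prod_type, conjTranspose_apply, kroneckerMap_apply,
    one_apply, mul_ite, mul_one, mul_zero, ite_mul, zero_mul, Finset.sum_ite_eq, Finset.mem_univ,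
    if_true, vecMulVec_apply, Finset.sum_mul, Pi.star_apply, apply_ite star, star_zero]
  rw [Finset.sum_comm]
  exact Finset.sum_congr rfl fun a _ => Finset.sum_congr rfl fun a' _ => by ring

theorem completelyPositive_of_choi {Φ : LMap A B} (h : (choi Φ).PosSemidef) :
    CompletelyPositive Φ := by
  classical
  intro X hX
  obtain ⟨Z, rfl⟩ := exists_eq_conjTranspose_mul_self hX
  -- `Zᴴ * Z` is the sum of the rank-one operators of the conjugated rows of `Z`.
  have : idTensor A Φ (Zᴴ * Z) = ∑ k, idTensor A Φ
      (vecMulVec (fun x => (Matrix.of fun r a => star (Z k (r, a)) : Matrix A A ℂ) x.1 x.2)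
        (star fun x => (Matrix.of fun r a => star (Z k (r, a)) : Matrix A A ℂ) x.1 x.2)) := by
    ext ⟨r, b⟩ ⟨r', b'⟩
    simp only [Matrix.sum_apply, idTensor_eq_sum_choi, Matrix.mul_apply, vecMulVec_apply,
      conjTranspose_apply, Finset.sum_mul, Matrix.of_apply, Pi.star_apply, star_star]
    rw [Finset.sum_comm]
    simp_rw [Finset.sum_comm (s := (Finset.univ : Finset A)) (t := (Finset.univ : Finset (A × A)))]
    exact Finset.sum_congr rfl fun _ _ => Finset.sum_comm
  rw [this]
  exact Matrix.posSemidef_sum _ fun k _ => by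
    rw [idTensor_vecMulVec]
    exact h.mul_mul_conjTranspose_same _

theorem completelyPositive_iff (Φ : LMap A B) :
    CompletelyPositive Φ ↔ (choi Φ).PosSemidef :=
  ⟨choi_posSemidef, completelyPositive_of_choi⟩

theorem traceNonincreasing_iff {Φ : LMap A B} (hΦ : (choi Φ).IsHermitian) :
    TraceNonincreasing Φ ↔ (1 - partialTrace (choi Φ)).PosSemidef := by
  have hT := partialTrace_isHermitian hΦ
  have key (X : Matrix A A ℂ) : X.trace - (Φ X).trace =
      (X * (1 - partialTrace (choi Φ))ᵀ).trace := by
    rw [trace_apply_eq, transpose_sub, transpose_one, Matrix.mul_sub, Matrix.trace_sub,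
      Matrix.mul_one]
  have hT' : (1 - partialTrace (choi Φ)).IsHermitian := isHermitian_one.sub hT
  constructor
  · intro h
    rw [← posSemidef_transpose_iff]
    refine posSemidef_of_re_dotProduct_nonneg hT'.transpose fun v => ?_
    have h1 := h _ (posSemidef_vecMulVec_self_star v)
    rw [← sub_nonneg, key, Matrix.trace_mul_comm, trace_mul_vecMulVec_star] at h1
    exact (Complex.nonneg_iff.mp h1).1
  · intro h X hX
    rw [← sub_nonneg, key, Complex.nonneg_iff]
    exact ⟨trace_mul_re_nonneg hX h.transpose,
      (IsHermitian.im_trace_mul hX.1 hT'.transpose).symm⟩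

theorem mem_CPTP_iff (Φ : LMap A B) :
    Φ ∈ CPTP A B ↔ (choi Φ).PosSemidef ∧ partialTrace (choi Φ) = 1 :=
  and_congr (completelyPositive_iff Φ) (tracePreserving_iff Φ)

theorem mem_CPTNI_iff (Φ : LMap A B) :
    Φ ∈ CPTNI A B ↔ (choi Φ).PosSemidef ∧ (1 - partialTrace (choi Φ)).PosSemidef := by
  constructor
  · rintro ⟨h1, h2⟩
    have h3 := choi_posSemidef h1
    exact ⟨h3, (traceNonincreasing_iff h3.1).mp h2⟩
  · rintro ⟨h1, h2⟩
    exact ⟨completelyPositive_of_choi h1, (traceNonincreasing_iff h1.1).mpr h2⟩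

/-- Both `X + Xᴴ` and `i (X - Xᴴ)` are Hermitian, and by linearity they determine `Φ X` and `Φ Xᴴ`.
-/
theorem HermiticityPreserving.map_conjTranspose {Φ : LMap A B} (hΦ : HermiticityPreserving Φ)
    (X : Matrix A A ℂ) : Φ Xᴴ = (Φ X)ᴴ := by
  have h1 := hΦ (X + Xᴴ) (by rw [IsHermitian, conjTranspose_add, conjTranspose_conjTranspose,
    add_comm])
  have h2 := hΦ (Complex.I • (X - Xᴴ)) (by
    rw [IsHermitian, conjTranspose_smul, conjTranspose_sub, conjTranspose_conjTranspose]
    simp [← smul_neg])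
  rw [IsHermitian, map_add, conjTranspose_add] at h1
  rw [IsHermitian, map_smul, map_sub, conjTranspose_smul, conjTranspose_sub] at h2
  ext b b'
  have e1 := congrFun₂ h1 b b'
  have e2 := congrFun₂ h2 b b'
  simp only [Matrix.add_apply, Matrix.smul_apply, Matrix.sub_apply, smul_eq_mul,
    Complex.star_def, Complex.conj_I] at e1 e2
  have e3 : (Φ X)ᴴ b b' - (Φ Xᴴ)ᴴ b b' = -(Φ X b b' - Φ Xᴴ b b') := by
    apply mul_left_cancel₀ Complex.I_ne_zero
    linear_combination -e2
  linear_combination (-1/2) * e1 - (1/2) * e3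

theorem HermiticityPreserving.idTensor_isHermitian {Φ : LMap A B} (hΦ : HermiticityPreserving Φ)
    {X : Matrix (R × A) (R × A) ℂ} (hX : X.IsHermitian) : (idTensor R Φ X).IsHermitian := by
  ext ⟨r, b⟩ ⟨r', b'⟩
  simp only [conjTranspose_apply, idTensor, Matrix.of_apply]
  rw [← conjTranspose_apply, ← hΦ.map_conjTranspose]
  refine congrArg (fun Y => Φ Y b b') (Matrix.ext fun a a' => ?_)
  simp [hX.apply]

theorem HermiticityPreserving.choi_isHermitian {Φ : LMap A B} (hΦ : HermiticityPreserving Φ) :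
    (choi Φ).IsHermitian :=
  hΦ.idTensor_isHermitian (posSemidef_vecMulVec_self_star _).1

theorem hermiticityPreserving_of_choi {Φ : LMap A B} (h : (choi Φ).IsHermitian) :
    HermiticityPreserving Φ := by
  intro X hX
  ext b b'
  simp only [conjTranspose_apply, apply_eq_sum_choi Φ, star_sum, star_mul']
  rw [Finset.sum_comm]
  exact Finset.sum_congr rfl fun a _ => Finset.sum_congr rfl fun a' _ => by
    rw [hX.apply, h.apply]

theorem CompletelyPositive.hermiticityPreserving {Φ : LMap A B} (h : CompletelyPositive Φ) :
    HermiticityPreserving Φ :=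
  hermiticityPreserving_of_choi (choi_posSemidef h).1

/-- The trace-and-replace channel: every state is sent to the maximally mixed one. -/
noncomputable def depolarizing (A B : Type*) [Fintype A] [Fintype B] [DecidableEq A]
    [DecidableEq B] : LMap A B :=
  ofChoi ((Fintype.card B : ℝ)⁻¹ • (1 : Matrix (A × B) (A × B) ℂ))

theorem choi_depolarizing [DecidableEq B] :
    choi (depolarizing A B) = (Fintype.card B : ℝ)⁻¹ • (1 : Matrix (A × B) (A × B) ℂ) :=
  choi_ofChoi _

/-- Every trace-nonincreasing completely positive map is dominated by a channel. -/
theorem exists_CPTP_of_CPTNI [DecidableEq B] [Nonempty B] {Λ : LMap A B} (h : Λ ∈ CPTNI A B) :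
    ∃ Λ' ∈ CPTP A B, (choi Λ' - choi Λ).PosSemidef := by
  obtain ⟨h1, h2⟩ := (mem_CPTNI_iff Λ).mp h
  -- The missing partial trace is spread uniformly over `B`.
  have hE : ((Fintype.card B : ℝ)⁻¹ • ((1 - partialTrace (choi Λ)) ⊗ₖ
      (1 : Matrix B B ℂ))).PosSemidef := (h2.kronecker .one).smul (by positivity)
  refine ⟨ofChoi (choi Λ + (Fintype.card B : ℝ)⁻¹ • ((1 - partialTrace (choi Λ)) ⊗ₖ
      (1 : Matrix B B ℂ))), ?_, ?_⟩
  · rw [mem_CPTP_iff, choi_ofChoi]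
    refine ⟨h1.add hE, ?_⟩
    rw [partialTrace_add, partialTrace_smul, partialTrace_kronecker_one, smul_smul,
      inv_mul_cancel₀ (by simp), one_smul, add_sub_cancel]
  · rw [choi_ofChoi, add_sub_cancel_left]
    exact hE

theorem depolarizing_mem_CPTP [DecidableEq B] [Nonempty B] : depolarizing A B ∈ CPTP A B := by
  rw [mem_CPTP_iff, choi_depolarizing]
  refine ⟨Matrix.PosSemidef.one.smul (by positivity), ?_⟩
  rw [← one_kronecker_one, partialTrace_smul, partialTrace_kronecker_one, smul_smul,
    inv_mul_cancel₀ (by simp), one_smul]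

theorem trace_idTensor {Φ : LMap A B} (hΦ : TracePreserving Φ) (X : Matrix (R × A) (R × A) ℂ) :
    (idTensor R Φ X).trace = X.trace := by
  simp only [Matrix.trace, Matrix.diag_apply, Fintype.sum_prod_type, idTensor, Matrix.of_apply]
  exact Finset.sum_congr rfl fun r _ => hΦ _

end Choi

/-! ### Convex duality for the robustness. -/

section Duality

open Matrix Filter Topology

set_option linter.unusedSectionVars false

variable [DecidableEq A] [DecidableEq B]

/-- The upper bounds of the partial traces of the positive operators above `J`. -/
def partialTraceBounds (J : Matrix (A × B) (A × B) ℂ) : Set (Matrix A A ℂ) :=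
  {Y | ∃ K : Matrix (A × B) (A × B) ℂ, K.PosSemidef ∧ (K - J).PosSemidef ∧
    (Y - partialTrace K).PosSemidef}

theorem continuous_partialTrace :
    Continuous (partialTrace : Matrix (A × B) (A × B) ℂ → Matrix A A ℂ) := by
  unfold partialTrace
  fun_prop

/-- Along a convergent sequence of bounds the traces stay bounded; they dominate the traces of the
witnesses `K`, so compactness gives a limiting witness. -/
theorem isClosed_partialTraceBounds (J : Matrix (A × B) (A × B) ℂ) :
    IsClosed (partialTraceBounds J) := by
  have : FirstCountableTopology (Matrix A A ℂ) :=
    inferInstanceAs (FirstCountableTopology (A → A → ℂ))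
  have : FirstCountableTopology (Matrix (A × B) (A × B) ℂ) :=
    inferInstanceAs (FirstCountableTopology (A × B → A × B → ℂ))
  refine IsSeqClosed.isClosed fun Y L hY hL => ?_
  choose K hK hKJ hKY using hY
  have htr : Continuous fun Y : Matrix A A ℂ => Y.trace.re := by fun_prop
  have hbdd : ∀ᶠ n in atTop, (Y n).trace.re ≤ L.trace.re + 1 :=
    ((htr.tendsto L).comp hL).eventually (eventually_le_nhds (by linarith))
  obtain ⟨N, hN⟩ := eventually_atTop.mp hbdd
  have hmem (n : ℕ) : K (n + N) ∈ {K : Matrix (A × B) (A × B) ℂ |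
      K.PosSemidef ∧ K.trace.re ≤ L.trace.re + 1} := by
    refine ⟨hK _, ?_⟩
    have := trace_re_nonneg (hKY (n + N))
    rw [Matrix.trace_sub, trace_partialTrace, Complex.sub_re] at this
    linarith [hN (n + N) (by omega)]
  obtain ⟨K₀, hK₀, φ, hφ, hlim⟩ := (isCompact_posSemidef_trace_le _).tendsto_subseq hmem
  have hLφ : Tendsto (fun n => Y (φ n + N)) atTop (𝓝 L) :=
    hL.comp ((tendsto_add_atTop_nat N).comp hφ.tendsto_atTop)
  refine ⟨K₀, hK₀.1, ?_, ?_⟩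
  · exact isClosed_posSemidef.mem_of_tendsto (hlim.sub_const J) (.of_forall fun n => hKJ _)
  · exact isClosed_posSemidef.mem_of_tendsto
      (hLφ.sub ((continuous_partialTrace.tendsto K₀).comp hlim)) (.of_forall fun n => hKY _)

theorem convex_partialTraceBounds (J : Matrix (A × B) (A × B) ℂ) :
    Convex ℝ (partialTraceBounds J) := by
  rintro Y ⟨K, h1, h2, h3⟩ Y' ⟨K', h1', h2', h3'⟩ s t hs ht hst
  refine ⟨s • K + t • K', (h1.smul hs).add (h1'.smul ht), ?_, ?_⟩
  · have : s • K + t • K' - J = s • (K - J) + t • (K' - J) := by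
      obtain rfl : t = 1 - s := by linarith
      module
    rw [this]
    exact (h2.smul hs).add (h2'.smul ht)
  · have : s • Y + t • Y' - partialTrace (s • K + t • K') =
        s • (Y - partialTrace K) + t • (Y' - partialTrace K') := by
      rw [partialTrace_add, partialTrace_smul, partialTrace_smul]
      module
    rw [this]
    exact (h3.smul hs).add (h3'.smul ht)

theorem partialTrace_mem_bounds {J K : Matrix (A × B) (A × B) ℂ} (hK : K.PosSemidef)
    (hKJ : (K - J).PosSemidef) : partialTrace K ∈ partialTraceBounds J :=
  ⟨K, hK, hKJ, by rw [sub_self]; exact .zero⟩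

theorem add_mem_partialTraceBounds {J : Matrix (A × B) (A × B) ℂ} {Y E : Matrix A A ℂ}
    (hY : Y ∈ partialTraceBounds J) (hE : E.PosSemidef) : Y + E ∈ partialTraceBounds J := by
  obtain ⟨K, h1, h2, h3⟩ := hY
  exact ⟨K, h1, h2, by rw [add_sub_right_comm]; exact h3.add hE⟩

/-- Uses `J ≤ ‖J‖₁ • 1`. It shows that the robustness problem is feasible and supplies a base point
for the separation argument. -/
theorem smul_one_mem_partialTraceBounds {J : Matrix (A × B) (A × B) ℂ} (hJ : J.IsHermitian) :
    ((traceNorm J * Fintype.card B : ℝ) • (1 : Matrix A A ℂ)) ∈ partialTraceBounds J := by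
  obtain ⟨-, -, -, -, -, -, -, -, -, -, h⟩ := exists_posPart_negPart hJ
  have := partialTrace_mem_bounds (Matrix.PosSemidef.one.smul (traceNorm_nonneg J)) h
  rwa [← one_kronecker_one, partialTrace_smul, partialTrace_kronecker_one, smul_smul] at this

/-- Real functionals on operators are trace pairings on the Hermitian operators. -/
theorem exists_trace_repr (f : Matrix R R ℂ →ₗ[ℝ] ℝ) :
    ∃ N : Matrix R R ℂ, N.IsHermitian ∧
      ∀ Y : Matrix R R ℂ, Y.IsHermitian → f Y = (N * Y).trace.re := by
  classical
  -- Chosen so that `Re (N b a * (x + i y)) = x f(E_ab) + y f(i E_ab)`. Only its Hermitian part is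
  -- felt by Hermitian `Y`.
  let N : Matrix R R ℂ := Matrix.of fun b a =>
    (f (single a b 1) : ℂ) - Complex.I * f (single a b Complex.I)
  have hN (Y : Matrix R R ℂ) : f Y = (N * Y).trace.re := by
    have hs (a b : R) (z : ℂ) :
        f (single a b z) = z.re * f (single a b 1) + z.im * f (single a b Complex.I) := by
      have : single a b z = z.re • single a b (1 : ℂ) + z.im • single a b Complex.I := by
        rw [smul_single, smul_single, ← single_add]
        congr 1
        simp
      rw [this, map_add, map_smul, map_smul, smul_eq_mul, smul_eq_mul]
    conv_lhs => rw [matrix_eq_sum_single Y]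
    simp only [map_sum, Matrix.trace, Matrix.diag_apply, Matrix.mul_apply, Complex.re_sum]
    rw [Finset.sum_comm]
    refine Finset.sum_congr rfl fun b _ => Finset.sum_congr rfl fun a _ => ?_
    rw [hs]
    simp [N]
    ring
  refine ⟨(1 / 2 : ℝ) • (N + Nᴴ), ?_, fun Y hY => ?_⟩
  · rw [IsHermitian, conjTranspose_smul, conjTranspose_add, conjTranspose_conjTranspose,
      add_comm]
    simp
  · have : (Nᴴ * Y).trace.re = (N * Y).trace.re := by
      rw [← hY.eq, ← conjTranspose_mul, trace_conjTranspose, hY.eq, Matrix.trace_mul_comm Y]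
      simp
    rw [Matrix.smul_mul, Matrix.add_mul, Matrix.trace_smul, Matrix.trace_add, Complex.smul_re,
      Complex.add_re, this, hN]
    simp
    ring

/-- The separation step: a scalar that bounds no partial trace is beaten by a nondegenerate
state. -/
theorem exists_posDef_of_notMem_bounds [Nonempty A] {J : Matrix (A × B) (A × B) ℂ}
    (hJ : J.IsHermitian) {μ : ℝ} (hμ : μ • (1 : Matrix A A ℂ) ∉ partialTraceBounds J) :
    ∃ ρ : Matrix A A ℂ, ρ.PosDef ∧ ρ.trace = 1 ∧
      ∀ K : Matrix (A × B) (A × B) ℂ, K.PosSemidef → (K - J).PosSemidef →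
        μ ≤ (ρ * partialTrace K).trace.re := by
  have : LocallyConvexSpace ℝ (Matrix A A ℂ) :=
    inferInstanceAs (LocallyConvexSpace ℝ (A → A → ℂ))
  obtain ⟨f, u, hu, hf⟩ := geometric_hahn_banach_point_closed (convex_partialTraceBounds J)
    (isClosed_partialTraceBounds J) hμ
  obtain ⟨N, hN, hfN⟩ := exists_trace_repr f.toLinearMap
  replace hfN : ∀ Y : Matrix A A ℂ, Y.IsHermitian → f Y = (N * Y).trace.re := hfN
  have hNpsd : N.PosSemidef := by
    refine posSemidef_of_re_dotProduct_nonneg hN fun v => ?_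
    have hv := posSemidef_vecMulVec_self_star v
    rw [← trace_mul_vecMulVec_star, ← hfN _ hv.1]
    by_contra! hneg
    set Y₀ := (traceNorm J * Fintype.card B : ℝ) • (1 : Matrix A A ℂ)
    have hY₀ : Y₀ ∈ partialTraceBounds J := smul_one_mem_partialTraceBounds hJ
    -- If `f` were negative on `v v*`, the ray from `Y₀` in that direction, which stays in the set,
    -- would reach `f = u` at this parameter.
    have ht : 0 ≤ (f Y₀ - u) / (-f (vecMulVec v (star v))) :=
      div_nonneg (by linarith [hf _ hY₀]) (by linarith)
    have := hf _ (add_mem_partialTraceBounds hY₀ (hv.smul ht))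
    rw [map_add, map_smul f _ (vecMulVec v (star v)), smul_eq_mul, div_neg, neg_mul, div_mul_cancel₀ _ hneg.ne] at this
    linarith
  have hμN : μ * N.trace.re < u := by
    have := hfN (μ • 1) (by rw [IsHermitian, conjTranspose_smul]; simp)
    rw [this] at hu
    simpa using hu
  set d : ℝ := (Fintype.card A : ℝ)
  -- The strict separation gap pays for replacing `N` by the invertible `N + δ • 1`; the `+ 1` keeps
  -- the denominator positive at `μ = 0`.
  set δ : ℝ := (u - μ * N.trace.re) / (|μ| * d + 1)
  have hden : 0 < |μ| * d + 1 := by positivity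
  have hδ : 0 < δ := div_pos (by linarith) hden
  have hδμ : μ * (δ * d) ≤ u - μ * N.trace.re := by
    have h1 : δ * (|μ| * d + 1) = u - μ * N.trace.re := div_mul_cancel₀ _ hden.ne'
    have h2 : μ * (δ * d) ≤ |μ| * (δ * d) :=
      mul_le_mul_of_nonneg_right (le_abs_self μ) (by positivity)
    nlinarith
  set ρ₁ : Matrix A A ℂ := N + δ • 1
  have hρ₁ : ρ₁.PosDef := Matrix.PosDef.posSemidef_add hNpsd (Matrix.PosDef.one.smul hδ)
  have htr : ρ₁.trace.re = N.trace.re + δ * d := by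
    simp [ρ₁, d]
  have htpos : 0 < ρ₁.trace.re := (Complex.pos_iff.mp hρ₁.trace_pos).1
  refine ⟨(ρ₁.trace.re)⁻¹ • ρ₁, hρ₁.smul (inv_pos.mpr htpos), ?_, fun K hK hKJ => ?_⟩
  · rw [Matrix.trace_smul]
    apply Complex.ext
    · simp [htpos.ne']
    · simp [IsHermitian.im_trace hρ₁.1]
  · have h1 := hf _ (partialTrace_mem_bounds hK hKJ)
    have hKp := partialTrace_posSemidef hK
    rw [hfN _ hKp.1] at h1
    have h2 : u ≤ (ρ₁ * partialTrace K).trace.re := by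
      have := mul_nonneg hδ.le (trace_re_nonneg hKp)
      simp only [ρ₁, Matrix.add_mul, Matrix.trace_add, Complex.add_re, Matrix.smul_mul,
        Matrix.one_mul, Matrix.trace_smul, Complex.smul_re, smul_eq_mul]
      linarith
    rw [Matrix.smul_mul, Matrix.trace_smul, Complex.smul_re, smul_eq_mul, inv_mul_eq_div,
      le_div_iff₀ htpos, htr]
    linarith

/-- Duality for the robustness: if `μ` is infeasible then some purified input state and effect
witness a value of at least `μ`. -/
theorem exists_witness_of_notMem_bounds [Nonempty A] {J : Matrix (A × B) (A × B) ℂ}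
    (hJ : J.IsHermitian) {μ : ℝ} (hμ : μ • (1 : Matrix A A ℂ) ∉ partialTraceBounds J) :
    ∃ (C : Matrix A A ℂ) (P : Matrix (A × B) (A × B) ℂ), (Cᴴ * C).trace = 1 ∧ P.PosSemidef ∧
      (1 - P).PosSemidef ∧
      μ ≤ (P * ((C ⊗ₖ (1 : Matrix B B ℂ)) * J * (C ⊗ₖ (1 : Matrix B B ℂ))ᴴ)).trace.re := by
  obtain ⟨ρ, hρ, hρ1, hmin⟩ := exists_posDef_of_notMem_bounds hJ hμ
  obtain ⟨C, rfl⟩ := exists_eq_conjTranspose_mul_self hρ.posSemidef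
  have hC : IsUnit C.det := by
    have := (Matrix.isUnit_iff_isUnit_det _).mp hρ.isUnit
    rw [det_mul] at this
    exact isUnit_of_mul_isUnit_right this
  set D : Matrix (A × B) (A × B) ℂ := C ⊗ₖ 1
  set E : Matrix (A × B) (A × B) ℂ := C⁻¹ ⊗ₖ 1
  have hED : E * D = 1 := by
    rw [← mul_kronecker_mul, Matrix.nonsing_inv_mul _ hC, Matrix.one_mul, one_kronecker_one]
  have hDE : D * E = 1 := by
    rw [← mul_kronecker_mul, Matrix.mul_nonsing_inv _ hC, Matrix.one_mul, one_kronecker_one]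
  obtain ⟨Y, Z, P, hY, hZ, hP, hP1, hXYZ, hPX, -, -⟩ :=
    exists_posPart_negPart (isHermitian_mul_mul_conjTranspose D hJ)
  refine ⟨C, P, hρ1, hP, hP1, ?_⟩
  rw [hPX]
  have hEH : Dᴴ * Eᴴ = 1 := by rw [← conjTranspose_mul, hED, conjTranspose_one]
  have hJE : E * (D * J * Dᴴ) * Eᴴ = J := by
    calc E * (D * J * Dᴴ) * Eᴴ = (E * D) * J * (Dᴴ * Eᴴ) := by simp only [Matrix.mul_assoc]
      _ = J := by rw [hED, hEH, Matrix.one_mul, Matrix.mul_one]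
  -- With `E = D⁻¹`, this `K` exceeds `J` by `E Z Eᴴ ≥ 0`, and its pairing with `ρ` is `Tr (Dᴴ D K)
  -- = Tr Y`.
  have h := hmin (E * Y * Eᴴ) (hY.mul_mul_conjTranspose_same E) (by
    have : E * Y * Eᴴ - J = E * Z * Eᴴ := by
      conv_lhs => rw [← hJE, hXYZ]
      rw [← Matrix.sub_mul, ← Matrix.mul_sub, sub_sub_cancel]
    rw [this]
    exact hZ.mul_mul_conjTranspose_same E)
  rw [← trace_kronecker_one_mul] at h
  have hDD : (Cᴴ * C) ⊗ₖ (1 : Matrix B B ℂ) = Dᴴ * D := by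
    rw [conjTranspose_kronecker, ← mul_kronecker_mul, conjTranspose_one, Matrix.one_mul]
  have : (Dᴴ * D * (E * Y * Eᴴ)).trace = Y.trace := by
    calc (Dᴴ * D * (E * Y * Eᴴ)).trace = (Dᴴ * ((D * E) * Y * Eᴴ)).trace := by
          simp only [Matrix.mul_assoc]
      _ = Y.trace := by
        rw [hDE, Matrix.one_mul, Matrix.trace_mul_comm, Matrix.mul_assoc,
          ← conjTranspose_mul, hDE, conjTranspose_one, Matrix.mul_one]
  rwa [hDD, this] at h

/-- Substituting `K = (1 + lam) J_Λ` makes the bilinear constraint linear. At `lam = -1` one cannot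
divide, but there the trace bound forces `K = 0`. -/
theorem mem_robustnessFeasible_iff (Φ : LMap A B) (lam : ℝ) :
    lam ∈ robustnessFeasible Φ ↔
      -1 ≤ lam ∧ (1 + lam) • (1 : Matrix A A ℂ) ∈ partialTraceBounds (choi Φ) := by
  refine and_congr_right fun hlam => ?_
  have h0 : 0 ≤ 1 + lam := by linarith
  constructor
  · rintro ⟨Λ, hΛ, h⟩
    obtain ⟨h1, h2⟩ := (mem_CPTNI_iff Λ).mp hΛ
    refine ⟨(1 + lam) • choi Λ, h1.smul h0, h, ?_⟩
    rw [partialTrace_smul, ← smul_sub]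
    exact h2.smul h0
  · rintro ⟨K, h1, h2, h3⟩
    rcases h0.eq_or_lt with h0 | h0
    · rw [← h0, zero_smul, zero_sub] at h3
      have hK : K = 0 := by
        rw [← h1.trace_eq_zero_iff]
        have e1 := trace_re_nonneg h3
        have e2 := trace_re_nonneg h1
        rw [Matrix.trace_neg, trace_partialTrace, Complex.neg_re] at e1
        exact Complex.ext (by simp; linarith) (by simp [IsHermitian.im_trace h1.1])
      subst hK
      refine ⟨ofChoi 0, ?_, ?_⟩
      · rw [mem_CPTNI_iff, choi_ofChoi]
        refine ⟨.zero, ?_⟩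
        simpa [partialTrace] using Matrix.PosSemidef.one (n := A) (R := ℂ)
      · rwa [← h0, zero_smul]
    · refine ⟨ofChoi ((1 + lam)⁻¹ • K), ?_, ?_⟩
      · rw [mem_CPTNI_iff, choi_ofChoi]
        refine ⟨h1.smul (inv_pos.mpr h0).le, ?_⟩
        have := h3.smul (inv_pos.mpr h0).le
        rwa [smul_sub, smul_smul, inv_mul_cancel₀ h0.ne', one_smul, ← partialTrace_smul] at this
      · rwa [choi_ofChoi, smul_smul, mul_inv_cancel₀ h0.ne', one_smul]

theorem isLeast_robustness {Φ : LMap A B} (hΦ : HermiticityPreserving Φ) :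
    IsLeast (robustnessFeasible Φ) (robustness' Φ) := by
  have hclosed : IsClosed (robustnessFeasible Φ) := by
    have : robustnessFeasible Φ = Set.Ici (-1) ∩
        (fun lam : ℝ => (1 + lam) • (1 : Matrix A A ℂ)) ⁻¹' partialTraceBounds (choi Φ) :=
      Set.ext fun lam => mem_robustnessFeasible_iff Φ lam
    rw [this]
    exact isClosed_Ici.inter ((isClosed_partialTraceBounds _).preimage (by fun_prop))
  refine hclosed.isLeast_csInf ⟨traceNorm (choi Φ) * Fintype.card B - 1, ?_⟩
    ⟨-1, fun x hx => hx.1⟩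
  rw [mem_robustnessFeasible_iff]
  refine ⟨?_, ?_⟩
  · have := mul_nonneg (traceNorm_nonneg (choi Φ)) (Nat.cast_nonneg (α := ℝ) (Fintype.card B))
    linarith
  · rw [add_sub_cancel]
    exact smul_one_mem_partialTraceBounds hΦ.choi_isHermitian

theorem notMem_bounds_of_lt_robustness [Nonempty A] {Φ : LMap A B}
    (hΦ : HermiticityPreserving Φ) {μ : ℝ} (hμ : μ < robustness' Φ + 1) :
    μ • (1 : Matrix A A ℂ) ∉ partialTraceBounds (choi Φ) := by
  intro h
  by_cases h0 : 0 ≤ μ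
  · have := (isLeast_robustness hΦ).2
      ((mem_robustnessFeasible_iff Φ (μ - 1)).mpr ⟨by linarith, by rwa [add_sub_cancel]⟩)
    linarith
  · obtain ⟨K, h1, -, h3⟩ := h
    have e1 := trace_re_nonneg h3
    have e2 := trace_re_nonneg h1
    rw [Matrix.trace_sub, trace_partialTrace, Complex.sub_re, Matrix.trace_smul, Matrix.trace_one,
      Complex.smul_re, Complex.natCast_re, smul_eq_mul] at e1
    have : μ * Fintype.card A < 0 :=
      mul_neg_of_neg_of_pos (not_le.mp h0) (Nat.cast_pos.mpr Fintype.card_pos)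
    linarith

end Duality

/-! ### Tomographically complete states and effects; functionals as games. -/

section Tomography

open Matrix

variable [DecidableEq A] [DecidableEq B] [DecidableEq R]

/-- The rank-one operators of the vectors `|a⟩ + i^k |a'⟩`. -/
noncomputable def polarization (a a' : R) (k : ℕ) : Matrix R R ℂ :=
  vecMulVec (Pi.single a 1 + Complex.I ^ k • Pi.single a' 1)
    (star (Pi.single a 1 + Complex.I ^ k • Pi.single a' 1))

theorem polarization_posSemidef (a a' : R) (k : ℕ) : (polarization a a' k).PosSemidef :=
  posSemidef_vecMulVec_self_star _

omit [Fintype R] in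
theorem polarization_eq (a a' : R) (k : ℕ) :
    polarization a a' k = single a a 1 + single a' a' 1 + (-Complex.I) ^ k • single a a' 1 +
      Complex.I ^ k • single a' a 1 := by
  have h : Complex.I ^ k * (-Complex.I) ^ k = 1 := by
    rw [← mul_pow]; simp
  have hs (i j : R) : (Pi.single i 1 : R → ℂ) j = if i = j then 1 else 0 := by
    simp [Pi.single_apply, eq_comm]
  ext i j
  simp only [polarization, vecMulVec_apply, Pi.add_apply, Pi.smul_apply, Pi.star_apply, hs,
    smul_eq_mul, star_add, star_mul', Matrix.add_apply, Matrix.smul_apply, single_apply,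
    Complex.star_def, map_pow, Complex.conj_I, apply_ite (starRingEnd ℂ), map_one, map_zero,
    ite_and]
  generalize Complex.I ^ k = z at *
  generalize (-Complex.I) ^ k = w at *
  split_ifs <;> simp <;> first | ring1 | linear_combination h

/-- Taking `a = a'` kills the diagonal units; then the phases `1` and `i` give two independent
equations for the units `E_aa'` and `E_a'a`. -/
theorem eq_zero_of_polarization {V : Type*} [AddCommGroup V] [Module ℂ V]
    (L : Matrix R R ℂ →ₗ[ℂ] V) (h : ∀ a a', ∀ k : Fin 2, L (polarization a a' k) = 0) :
    L = 0 := by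
  have h0 (a a' : R) := h a a' 0
  have h1 (a a' : R) := h a a' 1
  simp only [polarization_eq, map_add, map_smul, Fin.val_zero, Fin.val_one, pow_zero, pow_one,
    one_smul] at h0 h1
  have hd (a : R) : L (single a a 1) = 0 := by
    have : (4 : ℂ) • L (single a a 1) = 0 := by rw [← h0 a a]; module
    exact (smul_eq_zero.mp this).resolve_left (by norm_num)
  have ho (a a' : R) : L (single a a' 1) = 0 := by
    have e0 := h0 a a'
    have e1 := h1 a a'
    rw [hd, hd, zero_add, zero_add] at e0 e1
    have e2 : L (single a' a 1) = - L (single a a' 1) := (neg_eq_of_add_eq_zero_right e0).symm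
    rw [e2] at e1
    have : (-2 * Complex.I) • L (single a a' 1) = 0 := by rw [← e1]; module
    exact (smul_eq_zero.mp this).resolve_left (by simp)
  ext X
  rw [LinearMap.zero_apply, matrix_eq_sum_single X]
  simp only [map_sum]
  refine Finset.sum_eq_zero fun a _ => Finset.sum_eq_zero fun a' _ => ?_
  have : single a a' (X a a') = X a a' • single a a' (1 : ℂ) := by
    rw [smul_single, smul_eq_mul, mul_one]
  rw [this, map_smul, ho, smul_zero]

/-- States use only two phases: at `k = 2` and `a = a'` the vector vanishes and cannot be
normalised. -/
theorem trace_polarization_re_pos (a a' : R) (k : Fin 2) :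
    0 < (polarization a a' k).trace.re := by
  rw [polarization_eq]
  by_cases h : a = a'
  · subst h
    fin_cases k
    all_goals simp
    norm_num
  · have h' : a' ≠ a := Ne.symm h
    simp [trace_single_eq_of_ne _ _ _ h, trace_single_eq_of_ne _ _ _ h']

/-- Summing all four phases cancels the off-diagonal terms, leaving `4 (E_aa + E_a'a')`; hence
effects need four phases to form a POVM. -/
theorem sum_polarization :
    ∑ x : R × R × Fin 4, polarization x.1 x.2.1 x.2.2 =
      (8 * Fintype.card R : ℝ) • (1 : Matrix R R ℂ) := by
  have hone : ∑ a : R, single a a (1 : ℂ) = 1 := by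
    ext i j
    simp [Matrix.sum_apply, single_apply, one_apply, ite_and]
  have h4 (a a' : R) : ∑ k : Fin 4, polarization a a' k =
      (4 : ℝ) • (single a a (1 : ℂ) + single a' a' 1) := by
    simp only [Fin.sum_univ_four, polarization_eq]
    have h2 : Complex.I ^ 2 = -1 := Complex.I_sq
    have h3 : Complex.I ^ 3 = -Complex.I := by rw [pow_succ, h2]; ring
    have h2' : (-Complex.I) ^ 2 = -1 := by rw [neg_sq, h2]
    have h3' : (-Complex.I) ^ 3 = Complex.I := by rw [pow_succ, h2']; ring
    simp only [Fin.val_zero, Fin.val_one, Fin.val_two, show ((3 : Fin 4) : ℕ) = 3 from rfl,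
      pow_zero, pow_one, h2, h3, h2', h3', show (4 : ℝ) = ((4 : ℕ) : ℝ) by norm_num,
      Nat.cast_smul_eq_nsmul]
    module
  simp only [Fintype.sum_prod_type, h4, ← Finset.smul_sum, Finset.sum_add_distrib, hone,
    Finset.sum_const, Finset.card_univ]
  rw [← Nat.cast_smul_eq_nsmul ℝ]
  module

/-- The pure states of a tomographically complete ensemble. -/
noncomputable def tomographyState (x : A × A × Fin 2) : Matrix A A ℂ :=
  ((polarization x.1 x.2.1 x.2.2).trace.re)⁻¹ • polarization x.1 x.2.1 x.2.2

theorem tomographyState_mem (x : A × A × Fin 2) : tomographyState x ∈ densityOperators A := by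
  have hpos := trace_polarization_re_pos x.1 x.2.1 x.2.2
  have hp := polarization_posSemidef x.1 x.2.1 x.2.2
  refine ⟨hp.smul (inv_pos.mpr hpos).le, ?_⟩
  rw [tomographyState, Matrix.trace_smul]
  exact Complex.ext (by simp [hpos.ne']) (by simp [IsHermitian.im_trace hp.1])

/-- The effects of a tomographically complete measurement. -/
noncomputable def tomographyEffect (x : B × B × Fin 4) : Matrix B B ℂ :=
  (8 * Fintype.card B : ℝ)⁻¹ • polarization x.1 x.2.1 x.2.2

theorem tomographyEffect_posSemidef (x : B × B × Fin 4) : (tomographyEffect x).PosSemidef :=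
  (polarization_posSemidef _ _ _).smul (by positivity)

theorem sum_tomographyEffect [Nonempty B] : ∑ x, tomographyEffect (B := B) x = 1 := by
  simp only [tomographyEffect, ← Finset.smul_sum, sum_polarization]
  rw [smul_smul, inv_mul_cancel₀ (by simp), one_smul]

/-- Real parts suffice because the trace of a product of Hermitian operators is real; polarization
is then used once on each side. -/
theorem eq_zero_of_tomography [Nonempty B] {Φ : LMap A B} (hΦ : HermiticityPreserving Φ)
    (h : ∀ x y, ((tomographyEffect y)ᴴ * Φ (tomographyState x)).trace.re = 0) : Φ = 0 := by
  refine eq_zero_of_polarization Φ fun a a' k => ?_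
  have hpos := trace_polarization_re_pos a a' k
  set X := polarization a a' k
  have hX : (Φ X).IsHermitian := hΦ _ (polarization_posSemidef a a' k).1
  have : (Matrix.traceLinearMap B ℂ ℂ) ∘ₗ (LinearMap.mulRight ℂ (Φ X)) = 0 := by
    refine eq_zero_of_polarization _ fun b b' l => ?_
    have hP := polarization_posSemidef b b' l
    have := h (a, a', k) (b, b', l.castLE (by norm_num))
    rw [(tomographyEffect_posSemidef _).1.eq] at this
    simp only [tomographyEffect, tomographyState, Fin.val_castLE] at this
    rw [show Φ ((X.trace.re)⁻¹ • X) = (X.trace.re)⁻¹ • Φ X from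
      map_smul (Φ.restrictScalars ℝ) _ _, Matrix.smul_mul, Matrix.mul_smul, Matrix.trace_smul,
      Matrix.trace_smul, Complex.smul_re, Complex.smul_re, smul_eq_mul, smul_eq_mul] at this
    have hre : (polarization b b' l * Φ X).trace.re = 0 := by
      simpa [hpos.ne'] using this
    exact Complex.ext hre (IsHermitian.im_trace_mul hP.1 hX)
  rw [Matrix.ext_iff_trace_mul_left]
  intro Y
  simpa using congrArg (fun L => L Y) this

/-- The Hermiticity-preserving maps as a real vector space. -/
def hermiticityPreservingSubmodule (A B : Type*) [Fintype A] [Fintype B] :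
    Submodule ℝ (LMap A B) where
  carrier := {Φ | HermiticityPreserving Φ}
  add_mem' h h' := fun X hX => (h X hX).add (h' X hX)
  zero_mem' := fun _ _ => isHermitian_zero
  smul_mem' c _ h := fun X hX => (h X hX).smul (k := c) (IsSelfAdjoint.all c)

/-- Every real functional is the payoff of a game, on the Hermiticity-preserving maps. -/
theorem exists_game [Nonempty A] [Nonempty B] (f : LMap A B →ₗ[ℝ] ℝ) :
    ∃ G : Game A B, ∀ Φ, HermiticityPreserving Φ → G.payoff Φ = f Φ := by
  let ι := A × A × Fin 2
  let κ := B × B × Fin 4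
  let T : hermiticityPreservingSubmodule A B →ₗ[ℝ] (ι × κ → ℝ) :=
    { toFun := fun Φ x => ((tomographyEffect x.2)ᴴ * Φ.1 (tomographyState x.1)).trace.re
      map_add' := fun Φ Ψ => by ext x; simp [Matrix.mul_add]
      map_smul' := fun c Φ => by ext x; simp }
  have hT : LinearMap.ker T = ⊥ := by
    rw [LinearMap.ker_eq_bot']
    intro Φ h
    exact Subtype.ext (eq_zero_of_tomography Φ.2 fun x y => congrFun h (x, y))
  -- Injectivity of the statistics map `T` lets `f` factor as `g ∘ T`. The coefficients of `g`
  -- become the rewards, rescaled to cancel the uniform probabilities.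
  obtain ⟨S, hS⟩ := LinearMap.exists_leftInverse_of_injective (K := ℝ)
    (V := hermiticityPreservingSubmodule A B) (V' := ι × κ → ℝ) T hT
  let g : (ι × κ → ℝ) →ₗ[ℝ] ℝ := (f ∘ₗ (hermiticityPreservingSubmodule A B).subtype) ∘ₗ S
  let eι := Fintype.equivFin ι
  let eκ := Fintype.equivFin κ
  have hcard : (Fintype.card ι : ℝ) ≠ 0 := by simp
  let G : Game A B :=
    { n := Fintype.card ι
      m := Fintype.card κ
      p := fun _ => (Fintype.card ι : ℝ)⁻¹
      p_nonneg := fun _ => by positivity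
      p_sum := by
        rw [Finset.sum_const, Finset.card_univ, Fintype.card_fin, nsmul_eq_mul,
          mul_inv_cancel₀ hcard]
      σ := fun i => tomographyState (eι.symm i)
      σ_mem := fun i => tomographyState_mem _
      M := fun j => tomographyEffect (eκ.symm j)
      M_pos := fun j => tomographyEffect_posSemidef _
      M_sum := (Equiv.sum_comp eκ.symm _).trans sum_tomographyEffect
      w := fun i j => Fintype.card ι * g (Pi.single (eι.symm i, eκ.symm j) 1) }
  refine ⟨G, fun Φ hΦ => ?_⟩
  have h1 : f Φ = g (T ⟨Φ, hΦ⟩) := by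
    have := LinearMap.congr_fun hS ⟨Φ, hΦ⟩
    simp only [LinearMap.comp_apply, LinearMap.id_apply] at this
    simp [g, this]
  have hw (a b : ℝ) : Fintype.card ι * a * (Fintype.card ι : ℝ)⁻¹ * b = b * a := by
    field_simp
  rw [h1, LinearMap.pi_apply_eq_sum_univ, Fintype.sum_prod_type]
  simp only [Game.payoff, G, hw]
  rw [← Equiv.sum_comp eι.symm]
  refine Finset.sum_congr rfl fun i _ => ?_
  rw [← Equiv.sum_comp eκ.symm]
  refine Finset.sum_congr rfl fun j _ => ?_
  rw [smul_eq_mul]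
  congr 2
  ext x
  simp [Pi.single_apply, eq_comm]

end Tomography

/-! ### Bounds on payoffs and the suprema over games. -/

section Payoffs

open Matrix

set_option linter.unusedSectionVars false

variable [DecidableEq A] [DecidableEq B]

theorem Game.payoff_sub (G : Game A B) (Φ Ψ : LMap A B) :
    G.payoff (Φ - Ψ) = G.payoff Φ - G.payoff Ψ := by
  simp [Game.payoff, mul_sub]

theorem Game.payoff_smul (G : Game A B) (c : ℝ) (Φ : LMap A B) :
    G.payoff (c • Φ) = c * G.payoff Φ := by
  simp only [Game.payoff, Finset.mul_sum, LinearMap.smul_apply, Matrix.mul_smul,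
    Matrix.trace_smul, Complex.smul_re, smul_eq_mul]
  exact Finset.sum_congr rfl fun i _ => Finset.sum_congr rfl fun j _ => by ring

theorem Game.payoff_zero (G : Game A B) : G.payoff 0 = 0 := by
  simp [Game.payoff]

theorem ofChoi_choi (Φ : LMap A B) : ofChoi (choi Φ) = Φ :=
  LinearMap.ext fun X => Matrix.ext fun b b' => (apply_eq_sum_choi Φ X b b').symm

/-- Every operator on `A ⊗ B` is the operator of a game. -/
theorem exists_game_of_operator [Nonempty A] [Nonempty B] (W : Matrix (A × B) (A × B) ℂ) :
    ∃ G : Game A B, ∀ Φ, HermiticityPreserving Φ → G.payoff Φ = (W * choi Φ).trace.re :=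
  exists_game
    { toFun := fun Φ => (W * choi Φ).trace.re
      map_add' := fun Φ Ψ => by simp [choi_add, Matrix.mul_add]
      map_smul' := fun c Φ => by simp [choi_smul] }

theorem Game.isGreatest_channelPayoffs [Nonempty B] (G : Game A B) :
    IsGreatest G.channelPayoffs G.maxChannelPayoff := by
  set S : Set (Matrix (A × B) (A × B) ℂ) := {K | K.PosSemidef ∧ partialTrace K = 1}
  have hS : IsCompact S := by
    refine (isCompact_posSemidef_trace_le (Fintype.card A : ℝ)).of_isClosed_subset
      (isClosed_posSemidef.inter (isClosed_eq continuous_partialTrace continuous_const)) ?_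
    rintro K ⟨hK, hK1⟩
    refine ⟨hK, ?_⟩
    rw [← trace_partialTrace, hK1]
    simp
  have hc (X : Matrix A A ℂ) :
      Continuous fun K : Matrix (A × B) (A × B) ℂ => (ofChoi K : LMap A B) X := by
    refine continuous_matrix fun b b' => ?_
    simp only [ofChoi, LinearMap.coe_mk, AddHom.coe_mk, Matrix.of_apply]
    fun_prop
  have hcont : Continuous fun K : Matrix (A × B) (A × B) ℂ => G.payoff (ofChoi K) := by
    unfold Game.payoff
    fun_prop
  have himage : G.channelPayoffs = (fun K => G.payoff (ofChoi K)) '' S := by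
    ext x
    constructor
    · rintro ⟨Λ, hΛ, rfl⟩
      exact ⟨choi Λ, (mem_CPTP_iff Λ).mp hΛ, by simp only [ofChoi_choi]⟩
    · rintro ⟨K, hK, rfl⟩
      exact ⟨ofChoi K, by rwa [mem_CPTP_iff, choi_ofChoi], rfl⟩
  have hne : G.channelPayoffs.Nonempty := ⟨_, depolarizing A B, depolarizing_mem_CPTP, rfl⟩
  unfold Game.maxChannelPayoff
  rw [himage] at hne ⊢
  exact (hS.image hcont).isGreatest_sSup hne

theorem Game.payoff_le_max [Nonempty B] (G : Game A B) {Λ : LMap A B} (hΛ : Λ ∈ CPTP A B) :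
    G.payoff Λ ≤ G.maxChannelPayoff :=
  G.isGreatest_channelPayoffs.2 ⟨Λ, hΛ, rfl⟩

theorem Game.maxChannelPayoff_nonneg [Nonempty B] {G : Game A B}
    (hG : G ∈ gamesNonnegOn (CPTP A B)) : 0 ≤ G.maxChannelPayoff :=
  (hG _ depolarizing_mem_CPTP).trans (G.payoff_le_max depolarizing_mem_CPTP)

theorem gamesNonnegOn_CP_subset :
    gamesNonnegOn (CP A B) ⊆ gamesNonnegOn (CPTP A B) :=
  fun _ hG Γ hΓ => hG Γ hΓ.1

/-- The optimal robustness is attained at a channel. -/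
theorem exists_CPTP_dominating [Nonempty B] {Φ : LMap A B} (hΦ : HermiticityPreserving Φ) :
    ∃ Λ ∈ CPTP A B, CompletelyPositive ((robustness' Φ + 1) • Λ - Φ) := by
  obtain ⟨h1, Λ, hΛ, h⟩ := (isLeast_robustness hΦ).1
  obtain ⟨Λ', hΛ', h'⟩ := exists_CPTP_of_CPTNI hΛ
  refine ⟨Λ', hΛ', completelyPositive_of_choi ?_⟩
  have := h.add (h'.smul (a := 1 + robustness' Φ) (by linarith))
  rw [choi_sub, choi_smul]
  convert this using 1
  module

theorem robustness_add_one_nonneg {Φ : LMap A B} (hΦ : HermiticityPreserving Φ) :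
    0 ≤ robustness' Φ + 1 := by
  linarith [(isLeast_robustness hΦ).1.1]

theorem Game.payoff_le_robustness_mul [Nonempty B] {Φ : LMap A B} (hΦ : HermiticityPreserving Φ)
    {G : Game A B} (hG : G ∈ gamesNonnegOn (CP A B)) :
    G.payoff Φ ≤ (robustness' Φ + 1) * G.maxChannelPayoff := by
  obtain ⟨Λ, hΛ, h⟩ := exists_CPTP_dominating hΦ
  have h1 := hG _ h
  rw [Game.payoff_sub, Game.payoff_smul] at h1
  have := mul_le_mul_of_nonneg_left (G.payoff_le_max hΛ) (robustness_add_one_nonneg hΦ)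
  linarith

/-- The difference `μ • Λ - Φ` is completely positive with partial trace `(μ - 1) • 1`, so it is
zero or a positive multiple of a channel. Hence nonnegativity on channels is enough. -/
theorem Game.payoff_le_robustness_mul_of_tracePreserving [Nonempty A] [Nonempty B]
    {Φ : LMap A B} (hΦ : HermiticityPreserving Φ) (hT : TracePreserving Φ)
    {G : Game A B} (hG : G ∈ gamesNonnegOn (CPTP A B)) :
    G.payoff Φ ≤ (robustness' Φ + 1) * G.maxChannelPayoff := by
  obtain ⟨Λ, hΛ, h⟩ := exists_CPTP_dominating hΦ
  set μ := robustness' Φ + 1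
  have hJ := choi_posSemidef h
  have hp : partialTrace (choi (μ • Λ - Φ)) = (μ - 1) • (1 : Matrix A A ℂ) := by
    rw [choi_sub, choi_smul, partialTrace_sub, partialTrace_smul,
      ((mem_CPTP_iff Λ).mp hΛ).2, (tracePreserving_iff Φ).mp hT, sub_smul, one_smul]
  have htr : (choi (μ • Λ - Φ)).trace = ((μ - 1) * Fintype.card A : ℝ) := by
    rw [← trace_partialTrace, hp, Matrix.trace_smul, Matrix.trace_one]
    simp
  have hμ : 0 ≤ μ - 1 := by
    have := trace_re_nonneg hJ
    rw [htr, Complex.ofReal_re] at this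
    exact nonneg_of_mul_nonneg_left this (Nat.cast_pos.mpr Fintype.card_pos)
  have h1 : 0 ≤ G.payoff (μ • Λ - Φ) := by
    rcases hμ.eq_or_lt with h0 | h0
    · rw [← h0, zero_mul, Complex.ofReal_zero, hJ.trace_eq_zero_iff] at htr
      have : μ • Λ - Φ = 0 := by
        rw [← ofChoi_choi (μ • Λ - Φ), htr]
        ext
        simp [ofChoi]
      rw [this, Game.payoff_zero]
    · have hmem : (μ - 1)⁻¹ • (μ • Λ - Φ) ∈ CPTP A B := by
        rw [mem_CPTP_iff, choi_smul, partialTrace_smul, hp, smul_smul, inv_mul_cancel₀ h0.ne',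
          one_smul]
        exact ⟨hJ.smul (inv_pos.mpr h0).le, rfl⟩
      have := hG _ hmem
      rw [Game.payoff_smul] at this
      exact nonneg_of_mul_nonneg_right this (inv_pos.mpr h0)
  rw [Game.payoff_sub, Game.payoff_smul] at h1
  have := mul_le_mul_of_nonneg_left (G.payoff_le_max hΛ) (robustness_add_one_nonneg hΦ)
  linarith

theorem exists_game_of_posSemidef [Nonempty A] [Nonempty B] {W : Matrix (A × B) (A × B) ℂ}
    (hW : W.PosSemidef) : ∃ G ∈ gamesNonnegOn (CP A B),
      ∀ Φ, HermiticityPreserving Φ → G.payoff Φ = (W * choi Φ).trace.re := by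
  obtain ⟨G, hG⟩ := exists_game_of_operator W
  refine ⟨G, fun Γ hΓ => ?_, hG⟩
  rw [hG Γ (CompletelyPositive.hermiticityPreserving hΓ)]
  exact trace_mul_re_nonneg hW (choi_posSemidef hΓ)

/-- Values below the optimum are reached by games with nonzero denominator. -/
theorem exists_game_advantage_ge [Nonempty A] [Nonempty B] {Φ : LMap A B}
    (hΦ : HermiticityPreserving Φ) {μ : ℝ} (h0 : 0 < μ) (hμ : μ < robustness' Φ + 1) :
    ∃ G ∈ gamesNonnegOn (CP A B), G.maxChannelPayoff ≠ 0 ∧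
      μ ≤ G.payoff Φ / G.maxChannelPayoff := by
  obtain ⟨C, P, hC, hP, hP1, hle⟩ := exists_witness_of_notMem_bounds hΦ.choi_isHermitian
    (notMem_bounds_of_lt_robustness hΦ hμ)
  set D : Matrix (A × B) (A × B) ℂ := C ⊗ₖ 1
  have hcycle (Q J : Matrix (A × B) (A × B) ℂ) :
      (Q * (D * J * Dᴴ)).trace = (Dᴴ * Q * D * J).trace := by
    rw [← Matrix.mul_assoc, Matrix.trace_mul_comm]
    simp only [Matrix.mul_assoc]
  obtain ⟨G, hG, hpay⟩ := exists_game_of_posSemidef (hP.conjTranspose_mul_mul_same D)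
  have hPhi : μ ≤ G.payoff Φ := by
    rw [hpay Φ hΦ, ← hcycle]
    exact hle
  -- For a channel, `P ≤ 1` gives a payoff at most `Tr (D J_Λ Dᴴ) = Tr (Cᴴ C) = 1`.
  have hmax : G.maxChannelPayoff ≤ 1 := by
    obtain ⟨Λ, hΛ, hval⟩ := G.isGreatest_channelPayoffs.1
    rw [hval, hpay Λ (CompletelyPositive.hermiticityPreserving hΛ.1), ← hcycle]
    obtain ⟨hJ, hJ1⟩ := (mem_CPTP_iff Λ).mp hΛ
    have h1 := trace_mul_re_nonneg hP1 (hJ.mul_mul_conjTranspose_same D)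
    have h2 : (D * choi Λ * Dᴴ).trace = 1 := by
      rw [Matrix.mul_assoc, Matrix.trace_mul_comm, Matrix.mul_assoc, Matrix.trace_mul_comm,
        conjTranspose_kronecker, ← mul_kronecker_mul, conjTranspose_one, Matrix.one_mul,
        trace_kronecker_one_mul, hJ1, Matrix.mul_one, hC]
    rw [Matrix.sub_mul, Matrix.one_mul, Matrix.trace_sub, h2, Complex.sub_re,
      Complex.one_re] at h1
    linarith
  have hle' := Game.payoff_le_robustness_mul hΦ hG
  -- A nonpositive denominator would force `P(Φ) ≤ 0 < μ` by the upper bound.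
  have hpos : 0 < G.maxChannelPayoff := by
    by_contra! h
    have := mul_nonpos_of_nonneg_of_nonpos (robustness_add_one_nonneg hΦ) h
    linarith
  refine ⟨G, hG, hpos.ne', ?_⟩
  rw [le_div_iff₀ hpos]
  nlinarith

theorem isLUB_advantagesWithZero [Nonempty A] [Nonempty B] {Φ : LMap A B}
    (hΦ : HermiticityPreserving Φ) :
    IsLUB (advantagesWithZero (gamesNonnegOn (CP A B)) Φ) (robustness' Φ + 1) := by
  refine ⟨?_, fun b hb => ?_⟩
  · rintro _ ⟨G, hG, rfl⟩
    split_ifs with h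
    · exact robustness_add_one_nonneg hΦ
    · have hpos := (Game.maxChannelPayoff_nonneg (gamesNonnegOn_CP_subset hG)).lt_of_ne' h
      exact (div_le_iff₀ hpos).mpr (Game.payoff_le_robustness_mul hΦ hG)
  -- The zero game contributes the conventional ratio `0`, which settles the case `R' + 1 = 0`.
  · have hb0 : 0 ≤ b := by
      obtain ⟨G, hG, hpay⟩ := exists_game_of_posSemidef
        (Matrix.PosSemidef.zero (n := A × B) (R := ℂ))
      refine hb ⟨G, hG, ?_⟩
      rw [hpay Φ hΦ]
      simp
    refine le_of_forall_lt fun μ hμ => ?_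
    obtain ⟨ν, hν, hν'⟩ := exists_between hμ
    by_cases h0 : 0 < ν
    · obtain ⟨G, hG, hne, hle⟩ := exists_game_advantage_ge hΦ h0 hν'
      exact hν.trans_le (hle.trans (hb ⟨G, hG, by rw [if_neg hne]⟩))
    · linarith

/-- The hypothesis matters only when `R' + 1 = 0`. It then yields `v ≠ 0` with `⟨v, J v⟩ ≥ 0`, and
the game of `v v*` has nonnegative ratio, its denominator being positive thanks to the depolarizing
channel. -/
theorem isLUB_advantages_CP [Nonempty A] [Nonempty B] {Φ : LMap A B}
    (hΦ : HermiticityPreserving Φ) (hneg : ¬ (-choi Φ).PosDef) :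
    IsLUB (advantages (gamesNonnegOn (CP A B)) Φ) (robustness' Φ + 1) := by
  refine ⟨?_, fun b hb => ?_⟩
  · rintro _ ⟨G, hG, h, rfl⟩
    have hpos := (Game.maxChannelPayoff_nonneg (gamesNonnegOn_CP_subset hG)).lt_of_ne' h
    exact (div_le_iff₀ hpos).mpr (Game.payoff_le_robustness_mul hΦ hG)
  · have hlow : ∀ ν, 0 < ν → ν < robustness' Φ + 1 → ν ≤ b := fun ν h0 hν => by
      obtain ⟨G, hG, hne, hle⟩ := exists_game_advantage_ge hΦ h0 hν
      exact hle.trans (hb ⟨G, hG, hne, rfl⟩)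
    rcases (robustness_add_one_nonneg hΦ).eq_or_lt with h0 | h0
    · rw [← h0]
      have hH : (-choi Φ).IsHermitian := hΦ.choi_isHermitian.neg
      have : ∃ v : A × B → ℂ, v ≠ 0 ∧ 0 ≤ (star v ⬝ᵥ (choi Φ *ᵥ v)).re := by
        by_contra! hv
        refine hneg (.of_dotProduct_mulVec_pos hH fun v hv0 => ?_)
        rw [Complex.pos_iff]
        refine ⟨?_, (IsHermitian.im_dotProduct hH v).symm⟩
        rw [Matrix.neg_mulVec, dotProduct_neg, Complex.neg_re]
        linarith [hv v hv0]
      obtain ⟨v, hv0, hv⟩ := this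
      obtain ⟨G, hG, hpay⟩ := exists_game_of_posSemidef (posSemidef_vecMulVec_self_star v)
      have h1 : 0 ≤ G.payoff Φ := by
        rw [hpay Φ hΦ, Matrix.trace_mul_comm, trace_mul_vecMulVec_star]
        exact hv
      have h2 : 0 < G.maxChannelPayoff := by
        have hdep := depolarizing_mem_CPTP (A := A) (B := B)
        refine lt_of_lt_of_le ?_ (G.payoff_le_max hdep)
        rw [hpay _ (CompletelyPositive.hermiticityPreserving hdep.1), choi_depolarizing,
          Matrix.mul_smul, Matrix.mul_one, Matrix.trace_smul, Complex.smul_re, smul_eq_mul,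
          Matrix.trace_vecMulVec, dotProduct_comm]
        exact mul_pos (by positivity) (Complex.pos_iff.mp (dotProduct_star_self_pos_iff.mpr hv0)).1
      exact (div_nonneg h1 h2.le).trans (hb ⟨G, hG, h2.ne', rfl⟩)
    · refine le_of_forall_lt fun μ hμ => ?_
      obtain ⟨ν, hν, hν'⟩ := exists_between (max_lt hμ h0)
      exact ((le_max_left _ _).trans_lt hν).trans_le
        (hlow ν ((le_max_right _ _).trans_lt hν) hν')

theorem isLUB_advantages_CPTP [Nonempty A] [Nonempty B] {Φ : LMap A B}
    (hΦ : HermiticityPreserving Φ) (hT : TracePreserving Φ) (hneg : ¬ (-choi Φ).PosDef) :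
    IsLUB (advantages (gamesNonnegOn (CPTP A B)) Φ) (robustness' Φ + 1) := by
  refine ⟨?_, fun b hb => (isLUB_advantages_CP hΦ hneg).2 fun x hx => ?_⟩
  · rintro _ ⟨G, hG, h, rfl⟩
    have hpos := (Game.maxChannelPayoff_nonneg hG).lt_of_ne' h
    exact (div_le_iff₀ hpos).mpr (Game.payoff_le_robustness_mul_of_tracePreserving hΦ hT hG)
  · obtain ⟨G, hG, h, rfl⟩ := hx
    exact hb ⟨G, gamesNonnegOn_CP_subset hG, h, rfl⟩

theorem TracePreserving.not_posDef_neg_choi [Nonempty A] [Nonempty B] {Φ : LMap A B}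
    (hT : TracePreserving Φ) : ¬ (-choi Φ).PosDef := by
  intro h
  have h1 := (Complex.pos_iff.mp h.trace_pos).1
  rw [Matrix.trace_neg, ← trace_partialTrace, (tracePreserving_iff Φ).mp hT,
    Matrix.trace_one] at h1
  simp at h1
  have : (0 : ℝ) ≤ Fintype.card A := Nat.cast_nonneg _
  linarith

end Payoffs

/-! ### The diamond norm and its relation to the robustness. -/

section Diamond

open Matrix

variable [DecidableEq A] [DecidableEq B]

theorem isCompact_densityOperators : IsCompact (densityOperators R) := by
  refine (isCompact_posSemidef_trace_le (1 : ℝ)).of_isClosed_subset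
    (isClosed_posSemidef.inter
      (isClosed_eq (f := fun K : Matrix R R ℂ => K.trace) (by fun_prop) continuous_const)) ?_
  rintro ρ ⟨h1, h2⟩
  exact ⟨h1, by rw [h2]; simp⟩

theorem isCompact_effects [DecidableEq R] :
    IsCompact {P : Matrix R R ℂ | P.PosSemidef ∧ (1 - P).PosSemidef} := by
  refine (isCompact_posSemidef_trace_le (Fintype.card R : ℝ)).of_isClosed_subset
    (isClosed_posSemidef.inter (isClosed_posSemidef.preimage
      (f := fun P : Matrix R R ℂ => 1 - P) (by fun_prop))) ?_
  rintro P ⟨h1, h2⟩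
  refine ⟨h1, ?_⟩
  have := trace_re_nonneg h2
  simpa using this

/-- The variational formula for the trace norm makes this a joint maximum over states and effects of
a continuous function on a compact set, so continuity of the trace norm is not needed. -/
theorem isGreatest_diamondNorm [Nonempty A] {Φ : LMap A B} (hΦ : HermiticityPreserving Φ) :
    IsGreatest (diamondValues Φ) (diamondNorm Φ) := by
  set S : Set (Matrix (A × A) (A × A) ℂ × Matrix (A × B) (A × B) ℂ) :=
    densityOperators (A × A) ×ˢ {P | P.PosSemidef ∧ (1 - P).PosSemidef}
  have hS : IsCompact S := isCompact_densityOperators.prod isCompact_effects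
  let g : Matrix (A × A) (A × A) ℂ × Matrix (A × B) (A × B) ℂ → ℝ := fun x =>
    2 * (x.2 * idTensor A Φ x.1).trace.re - (idTensor A Φ x.1).trace.re
  have hid : Continuous fun X : Matrix (A × A) (A × A) ℂ => idTensor A Φ X := by
    refine continuous_matrix fun x y => ?_
    obtain ⟨r, b⟩ := x
    obtain ⟨r', b'⟩ := y
    simp only [idTensor_eq_sum_choi]
    fun_prop
  have hg : Continuous g := by fun_prop
  obtain ⟨a₀⟩ := ‹Nonempty A›
  have hne : S.Nonempty := by
    refine ⟨(vecMulVec (Pi.single (a₀, a₀) 1) (star (Pi.single (a₀, a₀) 1)), 0),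
      ⟨posSemidef_vecMulVec_self_star _, ?_⟩, .zero, ?_⟩
    · simp [Matrix.trace_vecMulVec]
    · rw [sub_zero]; exact .one
  obtain ⟨⟨ρ₀, P₀⟩, ⟨hρ₀, hP₀⟩, hmax⟩ := hS.exists_isMaxOn hne hg.continuousOn
  have htn {ρ : Matrix (A × A) (A × A) ℂ} (hρ : ρ ∈ densityOperators (A × A)) :=
    isGreatest_traceNorm (hΦ.idTensor_isHermitian hρ.1.1)
  have hgreat : IsGreatest (diamondValues Φ) (traceNorm (idTensor A Φ ρ₀)) := by
    refine ⟨⟨ρ₀, hρ₀, rfl⟩, ?_⟩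
    rintro _ ⟨ρ, hρ, rfl⟩
    obtain ⟨P, hP, hP1, hval⟩ := (htn hρ).1
    rw [hval]
    have h1 : g (ρ, P) ≤ g (ρ₀, P₀) := hmax (Set.mk_mem_prod hρ ⟨hP, hP1⟩)
    exact h1.trans ((htn hρ₀).2 ⟨P₀, hP₀.1, hP₀.2, rfl⟩)
  rw [diamondNorm, hgreat.csSup_eq]
  exact hgreat

theorem robustness_add_one_eq_diamondNorm [Nonempty A] [Nonempty B] {Φ : LMap A B}
    (hΦ : HermiticityPreserving Φ) (hT : TracePreserving Φ) :
    robustness' Φ + 1 = (diamondNorm Φ + 1) / 2 := by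
  have hgreat := isGreatest_diamondNorm hΦ
  refine le_antisymm (le_of_forall_lt fun μ hμ => ?_) ?_
  · obtain ⟨ν, hν, hν'⟩ := exists_between hμ
    refine hν.trans_le ?_
    obtain ⟨C, P, hC, hP, hP1, hle⟩ := exists_witness_of_notMem_bounds hΦ.choi_isHermitian
      (notMem_bounds_of_lt_robustness hΦ hν')
    -- The dual witness `C`, read as the coefficients of a unit vector in `A ⊗ A`, is the input
    -- state.
    have hρ : vecMulVec (fun x : A × A => C x.1 x.2) (star fun x => C x.1 x.2) ∈
        densityOperators (A × A) := by
      refine ⟨posSemidef_vecMulVec_self_star _, ?_⟩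
      rw [← hC, Matrix.trace_mul_comm, Matrix.trace_vecMulVec]
      simp [dotProduct, Fintype.sum_prod_type, Matrix.trace, Matrix.mul_apply]
    rw [← idTensor_vecMulVec] at hle
    have h1 := hgreat.2 ⟨_, hρ, rfl⟩
    have h2 := (isGreatest_traceNorm (hΦ.idTensor_isHermitian hρ.1.1)).2 ⟨P, hP, hP1, rfl⟩
    rw [trace_idTensor hT, hρ.2, Complex.one_re] at h2
    linarith
  · obtain ⟨ρ, hρ, hval⟩ := hgreat.1
    obtain ⟨P, hP, hP1, hval'⟩ := (isGreatest_traceNorm (hΦ.idTensor_isHermitian hρ.1.1)).1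
    rw [hval', trace_idTensor hT, hρ.2, Complex.one_re] at hval
    obtain ⟨Λ, hΛ, hD⟩ := exists_CPTP_dominating hΦ
    -- Together with the next bound: `Tr (P Φ(ρ)) ≤ (R' + 1) Tr (P Λ(ρ)) ≤ R' + 1`, where the maps
    -- act on the second factor.
    have h1 := trace_mul_re_nonneg hP (hD ρ hρ.1)
    have h2 := trace_mul_re_nonneg hP1 (hΛ.1 ρ hρ.1)
    have hlin : idTensor A ((robustness' Φ + 1) • Λ - Φ) ρ =
        (robustness' Φ + 1) • idTensor A Λ ρ - idTensor A Φ ρ := by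
      ext
      simp [idTensor]
    rw [hlin, Matrix.mul_sub, Matrix.trace_sub, Matrix.mul_smul, Matrix.trace_smul,
      Complex.sub_re, Complex.smul_re, smul_eq_mul] at h1
    rw [Matrix.sub_mul, Matrix.one_mul, Matrix.trace_sub, trace_idTensor hΛ.2, hρ.2,
      Complex.sub_re, Complex.one_re] at h2
    have := mul_nonneg (robustness_add_one_nonneg hΦ) h2
    linarith

end Diamond

end QuantumGames

theorem theorem3 {A B : Type*} [Fintype A] [Fintype B] [DecidableEq A] [DecidableEq B]
    [Nonempty A] [Nonempty B] (Φ : QuantumGames.LMap A B)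
    (hΦ : QuantumGames.HermiticityPreserving Φ) :
    -- the extrema in the definitions exist
    IsLeast (QuantumGames.robustnessFeasible Φ) (QuantumGames.robustness' Φ) ∧
    IsGreatest (QuantumGames.diamondValues Φ) (QuantumGames.diamondNorm Φ) ∧
    (∀ G : QuantumGames.Game A B, IsGreatest G.channelPayoffs G.maxChannelPayoff) ∧
    -- arbitrary Hermiticity-preserving maps
    IsLUB (QuantumGames.advantagesWithZero
        (QuantumGames.gamesNonnegOn (QuantumGames.CP A B)) Φ)
      (QuantumGames.robustness' Φ + 1) ∧
    (¬ (-QuantumGames.choi Φ).PosDef →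
      IsLUB (QuantumGames.advantages
          (QuantumGames.gamesNonnegOn (QuantumGames.CP A B)) Φ)
        (QuantumGames.robustness' Φ + 1)) ∧
    -- trace-preserving maps
    (QuantumGames.TracePreserving Φ →
      IsLUB (QuantumGames.advantages
          (QuantumGames.gamesNonnegOn (QuantumGames.CP A B)) Φ)
        ((QuantumGames.diamondNorm Φ + 1) / 2) ∧
      IsLUB (QuantumGames.advantages
          (QuantumGames.gamesNonnegOn (QuantumGames.CPTP A B)) Φ)
        ((QuantumGames.diamondNorm Φ + 1) / 2)) := by
  have hTP (hT : QuantumGames.TracePreserving Φ) :=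
    QuantumGames.robustness_add_one_eq_diamondNorm hΦ hT
  refine ⟨QuantumGames.isLeast_robustness hΦ, QuantumGames.isGreatest_diamondNorm hΦ,
    QuantumGames.Game.isGreatest_channelPayoffs, QuantumGames.isLUB_advantagesWithZero hΦ,
    QuantumGames.isLUB_advantages_CP hΦ, fun hT => ?_⟩
  rw [← hTP hT]
  exact ⟨QuantumGames.isLUB_advantages_CP hΦ hT.not_posDef_neg_choi,
    QuantumGames.isLUB_advantages_CPTP hΦ hT hT.not_posDef_neg_choi⟩
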